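/- **Caching in Matchings.** Let $V^{in}$ and $V^{out}$ be two sets of $n$ nodes each. A cache is a sequence of $k$ matchings $(M_1,\dots,M_k)$ between $V^{in}$ and $V^{out}$, initially all empty. Edges $(u,v)\in V^{in}\times V^{out}$ are requested one at a time; after each request the cache may be changed, and then the requested edge must belong to $M_1\cup\dots\cup M_k$. Each insertion of an edge into a matching costs $1$ (in particular, moving an edge from one matching to another costs $1$), and evictions are free. For a finite request sequence $\sigma$, let $OPT(\sigma)$ be the minimum total cost of serving $\sigma$ when all of $\sigma$ is known in advance. A deterministic online algorithm chooses the cache after each request as a function of the requests seen so far; a randomized online algorithm $A$ is a probability distribution over deterministic online algorithms. It is $c$-competitive if there is a number $d$ (independent of $\sigma$) such that $\mathbb{E}[cost(A(\sigma))]\le c\cdot OPT(\sigma)+d$ for every finite request sequence $\sigma$. **Theorem.** Every (randomized) online algorithm for Caching in Matchings has competitive ratio $\Omega\big(\log\frac{n}{k^2\log k}\cdot\log k\big)$. That is, there is an absolute constant $C>0$ such that for all integers $n,k$ with $2\le k<n$, every randomized online algorithm $A$ for Caching in Matchings with $n$ nodes on each side and $k$ matchings, and every real $c$ for which $A$ is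 $c$-competitive, $$c\;\ge\; C\cdot\log_2\!\Big(\frac{n}{k^2\log_2 k}\Big)\cdot\log_2 k .$$ -/

import Mathlib

open MeasureTheory

noncomputable section

namespace CachingInMatchings

/-- The edges of the complete bipartite graph with `n` nodes on each side; the pair `(u, v)` joins
the node `u` of `V^in` to the node `v` of `V^out`. -/
abbrev Edge (n : ℕ) : Type := Fin n × Fin n

/-- No two distinct edges of `M` share a node. -/
def IsMatching {n : ℕ} (M : Finset (Edge n)) : Prop :=
  ∀ e ∈ M, ∀ f ∈ M, (e.1 = f.1 ∨ e.2 = f.2) → e = f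

/-- A cache: `k` matchings, indexed by colors. -/
@[ext]
structure Cache (n k : ℕ) where
  /-- the matching of each color -/
  matching : Fin k → Finset (Edge n)
  /-- each of them is a matching -/
  isMatching : ∀ i, IsMatching (matching i)

namespace Cache

variable {n k : ℕ}

/-- The empty cache. -/
def empty (n k : ℕ) : Cache n k where
  matching := fun _ => ∅
  isMatching := fun _ e he => absurd he (Finset.notMem_empty e)

/-- The edge `e` is cached, that is, it lies in the union of the matchings. -/
def Holds (S : Cache n k) (e : Edge n) : Prop := ∃ i, e ∈ S.matching i

/-- The cost of changing the cache from `S` to `T`: every edge added to a matching costs `1`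
(so moving an edge to another matching costs `1` as well), and evictions are free. -/
def fetchCost (S T : Cache n k) : ℕ := ∑ i, (T.matching i \ S.matching i).card

instance : Finite (Cache n k) :=
  Finite.of_injective Cache.matching fun _ _ h => Cache.ext h

instance : MeasurableSpace (Cache n k) := ⊤

instance : DiscreteMeasurableSpace (Cache n k) := ⟨fun _ => trivial⟩

end Cache

variable {n k : ℕ}

/-- `s` is a way of serving the requests `σ`: it starts with the empty cache, and `s (t + 1)`, the
cache when the request with index `t` is served, holds the requested edge. -/
def Serves (s : ℕ → Cache n k) (σ : List (Edge n)) : Prop :=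
  s 0 = Cache.empty n k ∧ ∀ (t : ℕ) (ht : t < σ.length), (s (t + 1)).Holds σ[t]

/-- The total cost of the first `m` changes of the cache along `s`. -/
def scheduleCost (s : ℕ → Cache n k) (m : ℕ) : ℕ :=
  ∑ t ∈ Finset.range m, (s t).fetchCost (s (t + 1))

/-- The cost of the optimal offline algorithm on the request sequence `σ`, with `k` matchings. -/
def optCost (k : ℕ) (σ : List (Edge n)) : ℕ :=
  sInf {m | ∃ s : ℕ → Cache n k, Serves s σ ∧ scheduleCost s σ.length = m}

/-- A deterministic online algorithm: the cache after some requests is a function of these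
requests only, it is empty at the start, and it holds the edge that has just been requested. -/
structure OnlineAlgorithm (n k : ℕ) where
  /-- the cache after serving the requests of a list -/
  cacheAfter : List (Edge n) → Cache n k
  /-- the cache is initially empty -/
  cacheAfter_nil : cacheAfter [] = Cache.empty n k
  /-- the last request is served -/
  holds_last : ∀ (σ : List (Edge n)) (e : Edge n), (cacheAfter (σ ++ [e])).Holds e

namespace OnlineAlgorithm

/-- The cost of a deterministic online algorithm on a request sequence. -/
def cost (A : OnlineAlgorithm n k) (σ : List (Edge n)) : ℕ :=
  scheduleCost (fun t => A.cacheAfter (σ.take t)) σ.length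

/-- The σ-algebra generated by the caches after all the finite request sequences. -/
instance : MeasurableSpace (OnlineAlgorithm n k) :=
  ⨆ σ : List (Edge n), MeasurableSpace.comap (fun A => A.cacheAfter σ) ⊤

/-- An online algorithm serves every request sequence. -/
theorem serves (A : OnlineAlgorithm n k) (σ : List (Edge n)) :
    Serves (fun t => A.cacheAfter (σ.take t)) σ := by
  refine ⟨by simpa using A.cacheAfter_nil, fun t ht => ?_⟩
  have h := A.holds_last (σ.take t) σ[t]
  simpa [List.take_append_getElem] using h

theorem measurable_cacheAfter (σ : List (Edge n)) :
    Measurable fun A : OnlineAlgorithm n k => A.cacheAfter σ :=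
  Measurable.of_comap_le (le_iSup
    (fun σ : List (Edge n) => MeasurableSpace.comap
      (fun A : OnlineAlgorithm n k => A.cacheAfter σ) ⊤) σ)

theorem measurable_cost (σ : List (Edge n)) :
    Measurable fun A : OnlineAlgorithm n k => A.cost σ := by
  unfold cost scheduleCost
  refine Finset.measurable_fun_sum _ fun t _ => ?_
  exact (Measurable.of_discrete (f := fun p : Cache n k × Cache n k => p.1.fetchCost p.2)).comp
    ((measurable_cacheAfter _).prodMk (measurable_cacheAfter _))

theorem cost_le (A : OnlineAlgorithm n k) (σ : List (Edge n)) :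
    A.cost σ ≤ σ.length * (k * (n * n)) := by
  unfold cost scheduleCost Cache.fetchCost
  refine (Finset.sum_le_card_nsmul _ _ (k * (n * n)) fun t _ => ?_).trans (by simp)
  refine (Finset.sum_le_card_nsmul _ _ (n * n) fun i _ => ?_).trans (by simp)
  exact (Finset.card_le_univ _).trans (by simp)

end OnlineAlgorithm

/-- A randomized online algorithm: a probability distribution over the deterministic ones. -/
abbrev RandomizedAlgorithm (n k : ℕ) : Type := ProbabilityMeasure (OnlineAlgorithm n k)

namespace RandomizedAlgorithm

/-- The expected cost of a randomized online algorithm on a request sequence. -/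
def expectedCost (A : RandomizedAlgorithm n k) (σ : List (Edge n)) : ℝ :=
  ∫ B, (B.cost σ : ℝ) ∂(A : Measure (OnlineAlgorithm n k))

/-- The expectation that defines `expectedCost` always exists. -/
theorem integrable_cost (A : RandomizedAlgorithm n k) (σ : List (Edge n)) :
    Integrable (fun B : OnlineAlgorithm n k => (B.cost σ : ℝ))
      (A : Measure (OnlineAlgorithm n k)) := by
  refine Integrable.of_bound (C := ((σ.length * (k * (n * n)) : ℕ) : ℝ)) ?_ ?_
  · exact (Measurable.of_discrete.comp
      (OnlineAlgorithm.measurable_cost σ) : Measurable _).aestronglyMeasurable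
  · refine Filter.Eventually.of_forall fun B => ?_
    rw [Real.norm_natCast]
    exact_mod_cast B.cost_le σ

/-- `A` is `c`-competitive: up to an additive term that does not depend on the request sequence,
its expected cost is at most `c` times the optimal offline cost. -/
def IsCompetitive (A : RandomizedAlgorithm n k) (c : ℝ) : Prop :=
  ∃ d : ℝ, ∀ σ : List (Edge n), A.expectedCost σ ≤ c * (optCost k σ : ℝ) + d

end RandomizedAlgorithm

end CachingInMatchings

end

/-!
The lower bound comes from a recoloring game that an adversary plays with random bits.

*From caches to colorings.* A gadget is a `k`-regular bipartite graph with one edge removed. If a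
cache holds all of its edges, then exactly one color is missing at each of the two end nodes of the
removed edge, the ports, and counting the nodes covered by a color class shows that it is the same
color at both (`IsGadgetColoring.exists_missing`). So a cached gadget has a color. An edge between
ports of two gadgets forces their colors to be equal, and a common neighbor (a hub) of several ports
forces their colors to be distinct (`Layout.compatible_missingColor`). An algorithm pays at least
one insertion for each gadget that changes its color
(`Layout.card_missingColor_ne_le_fetchCost`). In the gadget used here, which lives on an elementary
abelian `2`-group, any change of color can also be done with at most nine insertions
(`Layout.fetchCost_coloredCache_le`). Requesting a set of edges in many rounds forces an algorithm
to hold the whole set at some moment or to pay for each round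
(`OnlineAlgorithm.rounds_cost_or_holds`).

*The game.* There are `2 ^ H` layers of `k` gadgets each, and in a layer the `k` colors are all
different. At level `j`, the layers of each block of `2 ^ j` consecutive layers are joined, so that
the coloring of one of them determines those of the others. The hidden permutation between the
colorings of two neighboring blocks is a translation of the labels by a vector of about `log k`
random bits. The bits are tested one after the other, by a hub that sees the labels with bit `0` in
one block and the labels without the announced bit in the other one. Whatever the coloring of the
algorithm is, each label with bit `0` is in conflict for one of the two possible values of the bit,
and resolving a conflict means to recolor all the `2 ^ j` layers of a block. So each tested bit
costs a constant fraction of all the gadgets on average (`card_changes_ge`). After the tests the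
pairs of blocks are joined accordingly, and the game continues at the next level. The offline
algorithm knows all the bits, chooses the final coloring at once, and then only pays for the wires
at the ends of the blocks (`serveBound_phase`). Starting at blocks of about `log k` layers, these
wires cost no more than a constant multiple of the number of gadgets. The number of tested bits is
the number of levels times `log k`. The gadgets need `O(k ^ 2)` nodes per layer, which leaves
about `log (n / (k ^ 2 * log k))` levels.

For `n` so small that there are only boundedly many levels, the bound `Ω(log k)` suffices. It is
obtained by the same bit-by-bit adversary from `k + 1` edges at a single node
(`ratio_ge_of_star`).

Randomization is dealt with by averaging over the next bit: for one of its two values the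
expected cost grows by at least half of the guaranteed total of the two branches
(`exists_expensive_phase`). Repeating phases eliminates the additive constant
(`ratio_le_of_adversary`).
-/

namespace CachingInMatchings

/-! ### Costs of caches and of online algorithms -/

section Costs

variable {n k : ℕ}

namespace Cache

theorem fetchCost_self (S : Cache n k) : S.fetchCost S = 0 := by
  simp [fetchCost]

theorem fetchCost_triangle (S T U : Cache n k) :
    S.fetchCost U ≤ S.fetchCost T + T.fetchCost U := by
  unfold fetchCost
  rw [← Finset.sum_add_distrib]
  refine Finset.sum_le_sum fun i _ => ?_
  refine (Finset.card_le_card ?_).trans (Finset.card_union_le _ _)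
  intro e he
  simp only [Finset.mem_sdiff, Finset.mem_union] at he ⊢
  tauto

theorem subset_of_fetchCost_eq_zero {S T : Cache n k} (h : S.fetchCost T = 0) (i : Fin k) :
    T.matching i ⊆ S.matching i := by
  unfold fetchCost at h
  rw [Finset.sum_eq_zero_iff] at h
  exact Finset.sdiff_eq_empty_iff_subset.1 (Finset.card_eq_zero.1 (h i (Finset.mem_univ i)))

end Cache

namespace OnlineAlgorithm

variable (A : OnlineAlgorithm n k)

theorem cost_concat (σ : List (Edge n)) (e : Edge n) :
    A.cost (σ ++ [e]) =
      A.cost σ + (A.cacheAfter σ).fetchCost (A.cacheAfter (σ ++ [e])) := by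
  unfold cost scheduleCost
  rw [List.length_append, List.length_singleton, Finset.sum_range_succ]
  congr 1
  · refine Finset.sum_congr rfl fun t ht => ?_
    have ht' := Finset.mem_range.1 ht
    beta_reduce
    rw [List.take_append_of_le_length (by omega), List.take_append_of_le_length (by omega)]
  · beta_reduce
    rw [List.take_append_of_le_length le_rfl, List.take_length,
      List.take_of_length_le (by simp)]

theorem cost_add_fetchCost_le (σ τ : List (Edge n)) :
    A.cost σ + (A.cacheAfter σ).fetchCost (A.cacheAfter (σ ++ τ)) ≤ A.cost (σ ++ τ) := by
  induction τ using List.reverseRecOn with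
  | nil => simp [Cache.fetchCost_self]
  | append_singleton τ e ih =>
    rw [← List.append_assoc, cost_concat]
    have := Cache.fetchCost_triangle (A.cacheAfter σ) (A.cacheAfter (σ ++ τ))
      (A.cacheAfter (σ ++ τ ++ [e]))
    omega

theorem cost_le_cost_append (σ τ : List (Edge n)) : A.cost σ ≤ A.cost (σ ++ τ) :=
  (Nat.le_add_right _ _).trans (A.cost_add_fetchCost_le σ τ)

/-- Requests that cost nothing were all cached before the first of them. -/
theorem holds_of_cost_append_eq {σ τ : List (Edge n)} (h : A.cost (σ ++ τ) = A.cost σ)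
    {e : Edge n} (he : e ∈ τ) : (A.cacheAfter σ).Holds e := by
  obtain ⟨τ₁, τ₂, rfl⟩ := List.append_of_mem he
  have h₁ := A.cost_add_fetchCost_le σ (τ₁ ++ [e])
  have h₂ := A.cost_le_cost_append (σ ++ (τ₁ ++ [e])) τ₂
  have h₃ : σ ++ (τ₁ ++ [e]) ++ τ₂ = σ ++ (τ₁ ++ e :: τ₂) := by simp
  rw [h₃] at h₂
  have h₀ : (A.cacheAfter σ).fetchCost (A.cacheAfter (σ ++ (τ₁ ++ [e]))) = 0 := by omega
  have h₄ := A.holds_last (σ ++ τ₁) e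
  rw [List.append_assoc] at h₄
  obtain ⟨i, hi⟩ := h₄
  exact ⟨i, Cache.subset_of_fetchCost_eq_zero h₀ i hi⟩

end OnlineAlgorithm

/-- The requests of the edges of `F`, one after the other, `r` times over; the order within
a round does not matter. -/
noncomputable def rounds (F : Finset (Edge n)) (r : ℕ) : List (Edge n) :=
  (List.replicate r F.toList).flatten

theorem mem_of_mem_rounds {F : Finset (Edge n)} {r : ℕ} {e : Edge n} (he : e ∈ rounds F r) :
    e ∈ F := by
  unfold rounds at he
  obtain ⟨l, hl, hel⟩ := List.mem_flatten.1 he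
  rw [List.eq_of_mem_replicate hl] at hel
  exact Finset.mem_toList.1 hel

namespace OnlineAlgorithm

variable (A : OnlineAlgorithm n k)

/-- Requesting a set of edges over and over costs at least one per round until the whole set is
cached at the same time. -/
theorem rounds_cost_or_holds (F : Finset (Edge n)) (r : ℕ) (σ : List (Edge n)) :
    A.cost σ + r ≤ A.cost (σ ++ rounds F r) ∨
      ∃ τ τ', τ ++ τ' = rounds F r ∧ ∀ e ∈ F, (A.cacheAfter (σ ++ τ)).Holds e := by
  induction r generalizing σ with
  | zero => left; simp [rounds]
  | succ r ih =>
    have hr : rounds F (r + 1) = F.toList ++ rounds F r := by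
      simp [rounds, List.replicate_succ]
    rw [hr]
    rcases Nat.eq_or_lt_of_le (A.cost_le_cost_append σ F.toList) with h | h
    · right
      refine ⟨[], _, rfl, fun e he => ?_⟩
      rw [List.append_nil]
      exact A.holds_of_cost_append_eq h.symm (Finset.mem_toList.2 he)
    · rcases ih (σ ++ F.toList) with h' | ⟨τ, τ', hτ, hF⟩
      · left
        rw [← List.append_assoc]
        omega
      · right
        refine ⟨F.toList ++ τ, τ', by rw [List.append_assoc, hτ], ?_⟩
        rwa [← List.append_assoc]

/-- If every cache holding `F` is far from the caches holding `F₀` or from those holding `F₁`,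
then an algorithm that is forced into `F` and afterwards into one of `F₀` and `F₁` pays in at
least one of the two cases. -/
theorem cost_fork (F F₀ F₁ : Finset (Edge n)) (g : ℕ)
    (hg : ∀ S T₀ T₁ : Cache n k, (∀ e ∈ F, S.Holds e) → (∀ e ∈ F₀, T₀.Holds e) →
      (∀ e ∈ F₁, T₁.Holds e) → g ≤ S.fetchCost T₀ + S.fetchCost T₁)
    (σ : List (Edge n)) :
    2 * A.cost σ + g ≤ A.cost (σ ++ (rounds F g ++ rounds F₀ g)) +
      A.cost (σ ++ (rounds F g ++ rounds F₁ g)) := by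
  have hmono : ∀ F', A.cost (σ ++ rounds F g) ≤ A.cost (σ ++ (rounds F g ++ rounds F' g)) :=
    fun F' => by
      rw [← List.append_assoc]
      exact A.cost_le_cost_append _ _
  have hσ := A.cost_le_cost_append σ (rounds F g)
  have m₀ := hmono F₀
  have m₁ := hmono F₁
  rcases A.rounds_cost_or_holds F g σ with h | ⟨τ, τ', hτ, hF⟩
  · omega
  rcases A.rounds_cost_or_holds F₀ g (σ ++ rounds F g) with h | ⟨τ₀, τ₀', hτ₀, hF₀⟩
  · rw [List.append_assoc] at h
    omega
  rcases A.rounds_cost_or_holds F₁ g (σ ++ rounds F g) with h | ⟨τ₁, τ₁', hτ₁, hF₁⟩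
  · rw [List.append_assoc] at h
    omega
  have key := hg _ _ _ hF hF₀ hF₁
  have dist : ∀ F' υ υ', υ ++ υ' = rounds F' g →
      A.cost σ + (A.cacheAfter (σ ++ τ)).fetchCost (A.cacheAfter (σ ++ rounds F g ++ υ)) ≤
        A.cost (σ ++ (rounds F g ++ rounds F' g)) := by
    intro F' υ υ' hυ
    have h₁ := A.cost_add_fetchCost_le (σ ++ τ) (τ' ++ υ)
    have h₂ := A.cost_le_cost_append σ τ
    have h₃ := A.cost_le_cost_append (σ ++ rounds F g ++ υ) υ'
    have e₁ : σ ++ τ ++ (τ' ++ υ) = σ ++ rounds F g ++ υ := by simp [← hτ]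
    have e₂ : σ ++ rounds F g ++ υ ++ υ' = σ ++ (rounds F g ++ rounds F' g) := by simp [← hυ]
    rw [e₁] at h₁
    rw [e₂] at h₃
    omega
  have d₀ := dist _ _ _ hτ₀
  have d₁ := dist _ _ _ hτ₁
  omega

end OnlineAlgorithm

/-- The requests `σ` can be served from the cache `S` in such a way that the cost of serving them,
together with the cost of changing the cache to `T` afterwards, is at most `m`. -/
def ServeBound (S : Cache n k) : List (Edge n) → Cache n k → ℕ → Prop
  | [], T, m => S.fetchCost T ≤ m
  | e :: σ, T, m => ∃ U : Cache n k, U.Holds e ∧ ∃ l, S.fetchCost U + l ≤ m ∧ ServeBound U σ T l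

namespace ServeBound

/-- Since the last change of the cache may be postponed, a change before the first request can be
merged with the change for this request. -/
theorem fetch_trans {S T U : Cache n k} {σ : List (Edge n)} {l m : ℕ}
    (h : S.fetchCost T ≤ l) (h' : ServeBound T σ U m) : ServeBound S σ U (l + m) := by
  cases σ with
  | nil =>
    have h'' : T.fetchCost U ≤ m := h'
    have := Cache.fetchCost_triangle S T U
    show S.fetchCost U ≤ l + m
    omega
  | cons e σ =>
    obtain ⟨V, hV, j, hj, hσ⟩ := h'
    have := Cache.fetchCost_triangle S T V
    exact ⟨V, hV, j, by omega, hσ⟩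

theorem append {S T U : Cache n k} {σ τ : List (Edge n)} {l m : ℕ}
    (h : ServeBound S σ T l) (h' : ServeBound T τ U m) : ServeBound S (σ ++ τ) U (l + m) := by
  induction σ generalizing S l with
  | nil => exact fetch_trans h h'
  | cons e σ ih =>
    obtain ⟨V, hV, j, hj, hσ⟩ := h
    exact ⟨V, hV, j + m, by omega, ih hσ⟩

theorem of_holds {S : Cache n k} {σ : List (Edge n)} (h : ∀ e ∈ σ, S.Holds e) :
    ServeBound S σ S 0 := by
  induction σ with
  | nil => exact (Cache.fetchCost_self S).le
  | cons e σ ih =>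
    exact ⟨S, h e (by simp), 0, by simp [Cache.fetchCost_self],
      ih fun f hf => h f (List.mem_cons_of_mem _ hf)⟩

theorem rounds {S T : Cache n k} {F : Finset (Edge n)} (r : ℕ) {m : ℕ}
    (h : S.fetchCost T ≤ m) (hT : ∀ e ∈ F, T.Holds e) :
    ServeBound S (rounds F r) T m :=
  fetch_trans (m := 0) h (of_holds fun _ he => hT _ (mem_of_mem_rounds he))

theorem mono {S T : Cache n k} {σ : List (Edge n)} {l m : ℕ} (h : ServeBound S σ T l)
    (hlm : l ≤ m) : ServeBound S σ T m := by
  cases σ with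
  | nil => exact le_trans h hlm
  | cons e σ =>
    obtain ⟨V, hV, j, hj, hσ⟩ := h
    exact ⟨V, hV, j, hj.trans hlm, hσ⟩

theorem exists_schedule {S T : Cache n k} {σ : List (Edge n)} {m : ℕ} (h : ServeBound S σ T m) :
    ∃ s : ℕ → Cache n k, s 0 = S ∧
      (∀ (t : ℕ) (ht : t < σ.length), (s (t + 1)).Holds σ[t]) ∧ scheduleCost s σ.length ≤ m := by
  induction σ generalizing S m with
  | nil => exact ⟨fun _ => S, rfl, fun t ht => absurd ht (by simp), by simp [scheduleCost]⟩
  | cons e σ ih =>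
    obtain ⟨V, hV, j, hj, hσ⟩ := h
    obtain ⟨s, hs, hs', hc⟩ := ih hσ
    refine ⟨fun t => Nat.casesOn t S s, rfl, ?_, ?_⟩
    · rintro (_ | t) ht
      · simpa [hs] using hV
      · simpa using hs' t (by simpa using ht)
    · unfold scheduleCost at hc ⊢
      rw [List.length_cons, Finset.sum_range_succ']
      have h₀ : Nat.casesOn (motive := fun _ => Cache n k) 0 S s = S := rfl
      simp only [hs, h₀]
      exact (Nat.add_comm _ _).le.trans ((Nat.add_le_add_left hc _).trans hj)

theorem optCost_le {T : Cache n k} {σ : List (Edge n)} {m : ℕ}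
    (h : ServeBound (Cache.empty n k) σ T m) : optCost k σ ≤ m := by
  obtain ⟨s, hs, hs', hc⟩ := h.exists_schedule
  exact le_trans (Nat.sInf_le (by exact ⟨s, ⟨hs, hs'⟩, rfl⟩)) hc

end ServeBound

end Costs

/-! ### The adversary -/

section Adversary

variable {n k : ℕ}

theorem expectedCost_fork (A : RandomizedAlgorithm n k) {σ σ₀ σ₁ : List (Edge n)} {g : ℕ}
    (h : ∀ B : OnlineAlgorithm n k, 2 * B.cost σ + g ≤ B.cost σ₀ + B.cost σ₁) :
    2 * A.expectedCost σ + g ≤ A.expectedCost σ₀ + A.expectedCost σ₁ := by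
  unfold RandomizedAlgorithm.expectedCost
  rw [← integral_add (A.integrable_cost σ₀) (A.integrable_cost σ₁), ← integral_const_mul]
  have hg : (g : ℝ) = ∫ _, (g : ℝ) ∂(A : Measure (OnlineAlgorithm n k)) := by simp
  conv_lhs => rw [hg]
  rw [← integral_add ((A.integrable_cost σ).const_mul 2) (integrable_const _)]
  refine integral_mono (((A.integrable_cost σ).const_mul 2).add (integrable_const _))
    ((A.integrable_cost σ₀).add (A.integrable_cost σ₁)) fun B => ?_
  exact_mod_cast h B

/-- The requests of the first `P` steps of an adversary who acts according to the bits `b`; the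
requests of step `t` are `req t b (b t)`. -/
def phase (req : ℕ → (ℕ → ZMod 2) → ZMod 2 → List (Edge n)) (b : ℕ → ZMod 2) :
    ℕ → List (Edge n)
  | 0 => []
  | P + 1 => phase req b P ++ req P b (b P)

theorem phase_congr {req : ℕ → (ℕ → ZMod 2) → ZMod 2 → List (Edge n)}
    (hloc : ∀ t b b', (∀ s < t, b s = b' s) → req t b = req t b') {b b' : ℕ → ZMod 2} {P : ℕ}
    (h : ∀ s < P, b s = b' s) : phase req b P = phase req b' P := by
  induction P with
  | zero => rfl
  | succ P ih =>
    have hP : ∀ s < P, b s = b' s := fun s hs => h s (by omega)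
    rw [phase, phase, ih hP, hloc P b b' hP, h P (by omega)]

/-- The bits can be fixed one after the other so that the expected cost grows by half of the total
cost of the two branches in each step. -/
theorem exists_expensive_phase {req : ℕ → (ℕ → ZMod 2) → ZMod 2 → List (Edge n)} {g P : ℕ}
    (hloc : ∀ t b b', (∀ s < t, b s = b' s) → req t b = req t b')
    (hgain : ∀ t < P, ∀ b, ∀ B : OnlineAlgorithm n k, ∀ σ,
      2 * B.cost σ + g ≤ B.cost (σ ++ req t b 0) + B.cost (σ ++ req t b 1))
    (A : RandomizedAlgorithm n k) (σ : List (Edge n)) :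
    ∃ b, A.expectedCost σ + P * (g / 2 : ℝ) ≤ A.expectedCost (σ ++ phase req b P) := by
  induction P with
  | zero => exact ⟨0, by simp [phase]⟩
  | succ P ih =>
    obtain ⟨b, hb⟩ := ih fun t ht => hgain t (by omega)
    have hext : ∀ x : ZMod 2, phase req (Function.update b P x) (P + 1) =
        phase req b P ++ req P b x := by
      intro x
      have hagree : ∀ s < P, Function.update b P x s = b s := fun s hs =>
        Function.update_of_ne (by omega) _ _
      rw [phase, phase_congr hloc hagree, hloc P _ b hagree, Function.update_self]
    have hfork := expectedCost_fork A (fun B => hgain P (by omega) b B (σ ++ phase req b P))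
    have : ∃ x : ZMod 2, A.expectedCost (σ ++ phase req b P) + g / 2 ≤
        A.expectedCost (σ ++ phase req b P ++ req P b x) := by
      by_contra! hcon
      have h₀ := hcon 0
      have h₁ := hcon 1
      linarith
    obtain ⟨x, hx⟩ := this
    refine ⟨Function.update b P x, ?_⟩
    rw [hext, ← List.append_assoc]
    push_cast
    linarith

/-- An adversary who makes an online algorithm pay `g / 2` in each of `P` steps, while the offline
cost of a phase of `P` steps is at most `m`, bounds the competitive ratio from below. The offline
algorithm may be in any cache of the set `Z` between two phases. -/
theorem ratio_le_of_adversary {req : ℕ → (ℕ → ZMod 2) → ZMod 2 → List (Edge n)} {g P m : ℕ}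
    (hloc : ∀ t b b', (∀ s < t, b s = b' s) → req t b = req t b')
    (hgain : ∀ t < P, ∀ b, ∀ B : OnlineAlgorithm n k, ∀ σ,
      2 * B.cost σ + g ≤ B.cost (σ ++ req t b 0) + B.cost (σ ++ req t b 1))
    {Z : Set (Cache n k)} (hZ : Z.Nonempty)
    (hopt : ∀ S ∈ Z, ∀ b, ∃ T ∈ Z, ServeBound S (phase req b P) T m)
    (hpos : 0 < P * g) {A : RandomizedAlgorithm n k} {c : ℝ} (hc : A.IsCompetitive c) :
    (P * g : ℝ) ≤ 2 * c * m := by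
  obtain ⟨d, hd⟩ := hc
  obtain ⟨S₀, hS₀⟩ := hZ
  set m₀ := (Cache.empty n k).fetchCost S₀ with hm₀
  have hiter : ∀ N : ℕ, ∃ σ : List (Edge n), N * (P * (g / 2 : ℝ)) ≤ A.expectedCost σ ∧
      ∃ T ∈ Z, ServeBound (Cache.empty n k) σ T (m₀ + N * m) := by
    intro N
    induction N with
    | zero =>
      refine ⟨[], ?_, S₀, hS₀, ?_⟩
      · simp only [Nat.cast_zero, zero_mul]
        exact integral_nonneg fun B => Nat.cast_nonneg _
      · show (Cache.empty n k).fetchCost S₀ ≤ _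
        omega
    | succ N ih =>
      obtain ⟨σ, hσ, T, hT, hserve⟩ := ih
      obtain ⟨b, hb⟩ := exists_expensive_phase hloc hgain A σ
      obtain ⟨U, hU, hserve'⟩ := hopt T hT b
      refine ⟨σ ++ phase req b P, ?_, U, hU, (hserve.append hserve').mono (le_of_eq (by ring))⟩
      push_cast
      linarith
  have hpos' : (0 : ℝ) < P * g := by exact_mod_cast hpos
  by_contra! hlt
  -- a linear function of the number of phases with a positive slope is eventually positive
  have hbound : ∀ N : ℕ, N * (P * (g / 2 : ℝ)) ≤ max c 0 * (m₀ + N * m) + d := by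
    intro N
    obtain ⟨σ, hσ, T, -, hserve⟩ := hiter N
    have h₁ : (optCost k σ : ℝ) ≤ m₀ + N * m := by exact_mod_cast hserve.optCost_le
    have h₂ : (0 : ℝ) ≤ optCost k σ := Nat.cast_nonneg _
    have h₃ : c * (optCost k σ : ℝ) ≤ max c 0 * (m₀ + N * m) :=
      mul_le_mul (le_max_left _ _) h₁ h₂ (le_max_right _ _)
    linarith [hd σ]
  have hslope : 0 < P * (g / 2 : ℝ) - max c 0 * m := by
    rcases le_total c 0 with h | h
    · rw [max_eq_right h]
      linarith
    · rw [max_eq_left h]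
      linarith
  obtain ⟨N, hN⟩ := exists_nat_gt ((max c 0 * m₀ + d) / (P * (g / 2 : ℝ) - max c 0 * m))
  rw [div_lt_iff₀ hslope] at hN
  linarith [hbound N]

end Adversary

/-! ### The missing color of a gadget -/

section Gadget

/-- The shape of a gadget: the left node `x` is to be joined with the right nodes `x + shift c`,
one for each color `c`, in a group of exponent two. The gadget itself is this `k`-regular bipartite
graph without the edge from the left node `0` to the right node `0`. -/
structure GadgetShape (k : ℕ) [NeZero k] (Y : Type*) [AddCommGroup Y] where
  /-- the displacement that belongs to a color -/
  shift : Fin k ↪ Y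
  /-- the color `0` belongs to the removed edge -/
  shift_zero : shift 0 = 0
  /-- the group has exponent two -/
  add_self : ∀ y : Y, y + y = 0

variable {k : ℕ} [NeZero k] {Y : Type*} [AddCommGroup Y]

/-- `E c x y` says that the left node `x` and the right node `y` are joined by an edge of color
`c`. The conditions say that each color class is a matching and that all the edges of the gadget
are present. An edge may have several colors. -/
structure IsGadgetColoring (D : GadgetShape k Y) (E : Fin k → Y → Y → Prop) : Prop where
  /-- a color occurs at most once at each left node -/
  left_unique : ∀ {c x y y'}, E c x y → E c x y' → y = y'
  /-- a color occurs at most once at each right node -/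
  right_unique : ∀ {c x x' y}, E c x y → E c x' y → x = x'
  /-- all the edges of the gadget are present -/
  joined : ∀ x d, ¬ (x = 0 ∧ d = 0) → ∃ c, E c x (x + D.shift d)

namespace GadgetShape

variable (D : GadgetShape k Y)

theorem add_add_self (D : GadgetShape k Y) (x y : Y) : x + y + y = x := by
  rw [add_assoc, D.add_self, add_zero]

theorem shift_ne_zero {d : Fin k} (hd : d ≠ 0) : D.shift d ≠ 0 := fun h =>
  hd (D.shift.injective (h.trans D.shift_zero.symm))

end GadgetShape

namespace IsGadgetColoring

variable {D : GadgetShape k Y} {E : Fin k → Y → Y → Prop}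

theorem flip (h : IsGadgetColoring D E) : IsGadgetColoring D fun c x y => E c y x where
  left_unique := h.right_unique
  right_unique := h.left_unique
  joined := by
    intro x d hx
    obtain ⟨c, hc⟩ := h.joined (x + D.shift d) d (by
      rintro ⟨h₁, rfl⟩
      rw [D.shift_zero, add_zero] at h₁
      exact hx ⟨h₁, rfl⟩)
    exact ⟨c, by rwa [D.add_add_self] at hc⟩

/-- A left node other than the port has as many edges as there are colors, hence each color. -/
theorem exists_color_at (h : IsGadgetColoring D E) {x : Y} (hx : x ≠ 0) (c : Fin k) :
    ∃ d, E c x (x + D.shift d) := by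
  choose χ hχ using fun d => h.joined x d fun hd => hx hd.1
  have hinj : Function.Injective χ := by
    intro d d' hdd
    have h₁ := hχ d'
    rw [← hdd] at h₁
    exact D.shift.injective (add_left_cancel (h.left_unique (hχ d) h₁))
  obtain ⟨d, rfl⟩ := Finite.surjective_of_injective hinj c
  exact ⟨d, hχ d⟩

/-- All the colors at a left node other than the port are used up, so no edge has two of them. -/
theorem color_unique (h : IsGadgetColoring D E) {x : Y} (hx : x ≠ 0) {c c' : Fin k} {d : Fin k}
    (hc : E c x (x + D.shift d)) (hc' : E c' x (x + D.shift d)) : c = c' := by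
  choose χ hχ using fun d => h.joined x d fun hd => hx hd.1
  have hinj : Function.Injective χ := by
    intro d d' hdd
    have h₁ := hχ d'
    rw [← hdd] at h₁
    exact D.shift.injective (add_left_cancel (h.left_unique (hχ d) h₁))
  have key : ∀ c, E c x (x + D.shift d) → c = χ d := by
    intro c hc
    obtain ⟨d', rfl⟩ := Finite.surjective_of_injective hinj c
    rw [D.shift.injective (add_left_cancel (h.left_unique (hχ d') hc))]
  rw [key c hc, key c' hc']

/-- A color class that covers the right port covers all the right nodes, hence all the left ones,
since there are equally many of them. -/
theorem left_of_right [Finite Y] (h : IsGadgetColoring D E) {c : Fin k}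
    (hc : ∃ d ≠ 0, E c (D.shift d) 0) : ∃ d ≠ 0, E c 0 (D.shift d) := by
  have hpart : ∀ y, ∃ d, ¬ (y = 0 ∧ d = 0) ∧ E c (y + D.shift d) y := by
    intro y
    by_cases hy : y = 0
    · obtain ⟨d, hd, hd'⟩ := hc
      exact ⟨d, fun h' => hd h'.2, by rwa [hy, zero_add]⟩
    · obtain ⟨d, hd⟩ := h.flip.exists_color_at hy c
      exact ⟨d, fun h' => hy h'.1, hd⟩
  choose φ hφ hφ' using hpart
  have hinj : Function.Injective fun y => y + D.shift (φ y) := by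
    intro y y' hyy
    have h₁ := hφ' y'
    dsimp only at hyy
    rw [← hyy] at h₁
    exact h.left_unique (hφ' y) h₁
  obtain ⟨y, hy⟩ := Finite.surjective_of_injective hinj 0
  dsimp only at hy
  have hyd : y = D.shift (φ y) := by
    have := D.add_add_self y (D.shift (φ y))
    rw [hy, zero_add] at this
    exact this.symm
  have h₁ := hφ' y
  rw [hy] at h₁
  refine ⟨φ y, fun h₀ => hφ y ⟨?_, h₀⟩, by rwa [← hyd]⟩
  rw [hyd, h₀, D.shift_zero]

/-- Exactly one color does not occur at the left port of a gadget, and the same color is the one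
that does not occur at its right port. -/
theorem exists_missing [Finite Y] (h : IsGadgetColoring D E) :
    ∃ c₀, ∀ c, ((∀ d ≠ 0, ¬ E c 0 (D.shift d)) ↔ c = c₀) ∧
      ((∀ d ≠ 0, ¬ E c (D.shift d) 0) ↔ c = c₀) := by
  have hex : ∀ d : Fin k, ∃ c, d ≠ 0 → E c 0 (D.shift d) := by
    intro d
    by_cases hd : d = 0
    · exact ⟨0, fun h' => absurd hd h'⟩
    · obtain ⟨c, hc⟩ := h.joined 0 d fun h' => hd h'.2
      exact ⟨c, fun _ => by rwa [zero_add] at hc⟩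
  choose χ hχ using hex
  have hinj : Set.InjOn χ (Finset.univ.erase (0 : Fin k) : Finset (Fin k)) := by
    intro d hd d' hd' hdd
    have h₀ := hχ d (Finset.ne_of_mem_erase hd)
    have h₁ := hχ d' (Finset.ne_of_mem_erase hd')
    rw [← hdd] at h₁
    exact D.shift.injective (h.left_unique h₀ h₁)
  have hmem : ∀ c, c ∈ (Finset.univ.erase (0 : Fin k)).image χ ↔
      ∃ d ≠ 0, E c 0 (D.shift d) := by
    intro c
    rw [Finset.mem_image]
    constructor
    · rintro ⟨d, hd, rfl⟩
      exact ⟨d, Finset.ne_of_mem_erase hd, hχ d (Finset.ne_of_mem_erase hd)⟩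
    · rintro ⟨d, hd, hc⟩
      refine ⟨d, Finset.mem_erase.2 ⟨hd, Finset.mem_univ d⟩, ?_⟩
      refine h.flip.color_unique (D.shift_ne_zero hd) (d := d) ?_ ?_
      · simpa only [D.add_self] using hχ d hd
      · simpa only [D.add_self] using hc
  have hcard : ((Finset.univ.erase (0 : Fin k)).image χ)ᶜ.card = 1 := by
    have hk := NeZero.pos k
    rw [Finset.card_compl, Finset.card_image_of_injOn hinj, Finset.card_erase_of_mem
      (Finset.mem_univ _), Finset.card_univ, Fintype.card_fin]
    omega
  obtain ⟨c₀, hc₀⟩ := Finset.card_eq_one.1 hcard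
  have hleft : ∀ c, (∀ d ≠ 0, ¬ E c 0 (D.shift d)) ↔ c = c₀ := by
    intro c
    rw [← Finset.mem_singleton, ← hc₀, Finset.mem_compl, hmem]
    push Not
    rfl
  refine ⟨c₀, fun c => ⟨hleft c, ?_⟩⟩
  rw [← hleft, ← not_iff_not]
  push Not
  exact ⟨h.left_of_right, h.flip.left_of_right⟩

end IsGadgetColoring

namespace GadgetShape

variable [DecidableEq Y] (D : GadgetShape k Y)

/-- The edges of a gadget can be colored so that `b` is missing at the ports: the edge from `x` to
`x + shift d` has color `d`, except that the colors `0` and `b` are exchanged on the four-cycle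
through the left nodes `0` and `shift b`. The removed edge belongs to this four-cycle, and it would
get the color `b`. -/
def edgeColor (b : Fin k) (x : Y) : Equiv.Perm (Fin k) :=
  if x = 0 ∨ x = D.shift b then Equiv.swap 0 b else 1

theorem edgeColor_zero_zero (b : Fin k) : D.edgeColor b 0 0 = b := by
  simp [edgeColor]

theorem edgeColor_zero_eq_iff {b d : Fin k} : D.edgeColor b 0 d = b ↔ d = 0 := by
  refine ⟨fun h => (D.edgeColor b 0).injective (h.trans (D.edgeColor_zero_zero b).symm), ?_⟩
  rintro rfl
  exact D.edgeColor_zero_zero b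

/-- The color of an edge can be read off at its right node in the same way. -/
theorem edgeColor_add_shift (b : Fin k) (x : Y) (d : Fin k) :
    D.edgeColor b (x + D.shift d) d = D.edgeColor b x d := by
  by_cases h0 : d = 0
  · rw [h0, D.shift_zero, add_zero]
  by_cases hb : d = b
  · subst hb
    have : (x + D.shift d = 0 ∨ x + D.shift d = D.shift d) ↔ (x = 0 ∨ x = D.shift d) := by
      rw [add_eq_right, or_comm]
      refine or_congr_right ⟨fun h => ?_, fun h => by rw [h, D.add_self]⟩
      have := D.add_add_self x (D.shift d)
      rw [h, zero_add] at this
      exact this.symm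
    simp only [edgeColor, this]
  · have key : ∀ y, D.edgeColor b y d = d := by
      intro y
      unfold edgeColor
      split_ifs
      · exact Equiv.swap_apply_of_ne_of_ne h0 hb
      · rfl
    rw [key, key]

theorem mem_of_edgeColor_ne {b b' : Fin k} {x : Y} {d : Fin k}
    (h : D.edgeColor b x d ≠ D.edgeColor b' x d) :
    x ∈ ({0, D.shift b, D.shift b'} : Finset Y) ∧ d ∈ ({0, b, b'} : Finset (Fin k)) := by
  constructor
  · contrapose! h
    simp only [Finset.mem_insert, Finset.mem_singleton, not_or] at h
    simp [edgeColor, h.1, h.2.1, h.2.2]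
  · contrapose! h
    simp only [Finset.mem_insert, Finset.mem_singleton, not_or] at h
    unfold edgeColor
    split_ifs <;>
      simp [Equiv.swap_apply_of_ne_of_ne h.1 h.2.1, Equiv.swap_apply_of_ne_of_ne h.1 h.2.2]

end GadgetShape

end Gadget

/-! ### Wired gadgets -/

section Wiring

/-- A placement of a family `G` of gadgets and of a family `W` of further right nodes, the hubs, in
the bipartite graph. -/
structure Layout (n k : ℕ) [NeZero k] (G W Y : Type*) [AddCommGroup Y] extends
    GadgetShape k Y where
  /-- the places of the nodes of the gadgets and of the hubs, the same on both sides -/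
  place : (G × Y) ⊕ W ↪ Fin n

/-- A wiring tells for each gadget whether its left port is joined to the right port of a gadget, or
to a hub, or not at all. A coloring of the gadgets is compatible with it if joined gadgets have the
same color and gadgets joined to the same node have different ones. -/
structure Compatible {k : ℕ} {G W : Type*} (π : G → Option (G ⊕ W)) (c : G → Fin k) : Prop where
  /-- joined gadgets have the same color -/
  link : ∀ {g h}, π g = some (.inl h) → c h = c g
  /-- gadgets joined to the same node have different colors -/
  inj : ∀ {g g' z}, π g = some z → π g' = some z → c g = c g' → g = g'

variable {n k : ℕ} [NeZero k] {G W Y : Type*} [AddCommGroup Y]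

namespace Layout

variable (L : Layout n k G W Y)

/-- The edge of the gadget `g` from its left node `x` to its right node `x + shift d`. -/
def gadgetEdge (g : G) (x : Y) (d : Fin k) : Edge n :=
  (L.place (.inl (g, x)), L.place (.inl (g, x + L.shift d)))

/-- The right node to which a port is joined: the right port of a gadget, or a hub. -/
def target (z : G ⊕ W) : Fin n := L.place (z.map (fun h => (h, 0)) id)

/-- The edge from the left port of the gadget `g` to the node `z`. -/
def wireEdge (g : G) (z : G ⊕ W) : Edge n := (L.place (.inl (g, 0)), L.target z)

theorem target_injective : Function.Injective L.target := by
  refine L.place.injective.comp (Function.Injective.sumMap ?_ Function.injective_id)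
  intro g g' h
  exact (Prod.mk.inj h).1

theorem target_eq_iff {z : G ⊕ W} {g : G} {y : Y} :
    L.target z = L.place (.inl (g, y)) ↔ z = .inl g ∧ y = 0 := by
  unfold target
  rw [L.place.injective.eq_iff]
  rcases z with h | w
  · simp [eq_comm]
  · simp

open Classical in
/-- The edges of all the gadgets and of the wiring. -/
noncomputable def graph (π : G → Option (G ⊕ W)) : Finset (Edge n) :=
  Finset.univ.filter fun e =>
    (∃ g x d, ¬ (x = 0 ∧ d = 0) ∧ e = L.gadgetEdge g x d) ∨ ∃ g z, π g = some z ∧ e = L.wireEdge g z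

theorem gadgetEdge_mem_graph (π : G → Option (G ⊕ W)) {g : G} {x : Y} {d : Fin k}
    (h : ¬ (x = 0 ∧ d = 0)) : L.gadgetEdge g x d ∈ L.graph π := by
  simp only [graph, Finset.mem_filter_univ]
  exact .inl ⟨g, x, d, h, rfl⟩

theorem wireEdge_mem_graph {π : G → Option (G ⊕ W)} {g : G} {z : G ⊕ W} (h : π g = some z) :
    L.wireEdge g z ∈ L.graph π := by
  simp only [graph, Finset.mem_filter_univ]
  exact .inr ⟨g, z, h, rfl⟩

open Classical in
/-- The color that is missing at the left port of the gadget `g`; the value `0` is only used if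
there is no such color. -/
noncomputable def missingColor (S : Cache n k) (g : G) : Fin k :=
  if h : ∃ c, ∀ d ≠ 0, L.gadgetEdge g 0 d ∉ S.matching c then h.choose else 0

section Settled

variable {L} {π : G → Option (G ⊕ W)} {S T : Cache n k}

theorem isGadgetColoring (hS : ∀ e ∈ L.graph π, S.Holds e) (g : G) :
    IsGadgetColoring L.toGadgetShape fun c x y =>
      (L.place (.inl (g, x)), L.place (.inl (g, y))) ∈ S.matching c where
  left_unique := by
    intro c x y y' h h'
    have := S.isMatching c _ h _ h' (.inl rfl)
    simpa using this
  right_unique := by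
    intro c x x' y h h'
    have := S.isMatching c _ h _ h' (.inr rfl)
    simpa using this
  joined := fun x d h => hS _ (L.gadgetEdge_mem_graph π h)

/-- In a cache that holds the gadget, its missing color is the only color that does not occur at its
left port, and also the only one that does not occur at its right port. -/
theorem missingColor_spec [Finite Y] (hS : ∀ e ∈ L.graph π, S.Holds e) (g : G) (c : Fin k) :
    ((∀ d ≠ 0, L.gadgetEdge g 0 d ∉ S.matching c) ↔ c = L.missingColor S g) ∧
      ((∀ d ≠ 0, (L.place (.inl (g, L.shift d)), L.place (.inl (g, 0))) ∉ S.matching c) ↔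
        c = L.missingColor S g) := by
  obtain ⟨c₀, hc₀⟩ := (isGadgetColoring hS g).exists_missing
  have hleft : ∀ c, (∀ d ≠ 0, L.gadgetEdge g 0 d ∉ S.matching c) ↔ c = c₀ := by
    intro c
    rw [← (hc₀ c).1]
    simp only [gadgetEdge, zero_add]
  have hex : ∃ c, ∀ d ≠ 0, L.gadgetEdge g 0 d ∉ S.matching c := ⟨c₀, (hleft c₀).2 rfl⟩
  have heq : L.missingColor S g = c₀ := by
    rw [missingColor, dif_pos hex, ← hleft]
    exact hex.choose_spec
  rw [heq]
  exact ⟨hleft c, (hc₀ c).2⟩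

/-- A cache that holds the graph of a wiring colors the gadgets compatibly with it, because the wire
at the left port of a gadget has to have the missing color of this gadget. -/
theorem compatible_missingColor [Finite Y] (hS : ∀ e ∈ L.graph π, S.Holds e) :
    Compatible π (L.missingColor S) := by
  -- the right port has the missing color of its gadget as well
  have hwire : ∀ {g z}, π g = some z → L.wireEdge g z ∈ S.matching (L.missingColor S g) := by
    intro g z hz
    obtain ⟨c, hc⟩ := hS _ (L.wireEdge_mem_graph hz)
    have : c = L.missingColor S g := by
      rw [← (missingColor_spec hS g c).1]
      intro d hd hd'
      have := S.isMatching c _ hc _ hd' (.inl rfl)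
      have h₂ : L.target z = L.place (.inl (g, 0 + L.shift d)) := (Prod.mk.inj this).2
      rw [L.target_eq_iff, zero_add] at h₂
      exact L.shift_ne_zero hd h₂.2
    rwa [this] at hc
  constructor
  · intro g h hg
    symm
    rw [← (missingColor_spec hS h _).2]
    intro d hd hd'
    have := S.isMatching _ _ (hwire hg) _ hd' (.inr rfl)
    have h₁ := (Prod.mk.inj this).1
    rw [L.place.injective.eq_iff] at h₁
    have h₂ := (Prod.mk.inj (Sum.inl_injective h₁)).2
    exact L.shift_ne_zero hd h₂.symm
  · intro g g' z hg hg' hc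
    have h₀ := hwire hg
    rw [hc] at h₀
    have := S.isMatching _ _ h₀ _ (hwire hg') (.inr rfl)
    have h₁ := (Prod.mk.inj this).1
    rw [L.place.injective.eq_iff] at h₁
    exact (Prod.mk.inj (Sum.inl_injective h₁)).1

open Classical in
/-- Each gadget whose missing color changes costs at least one insertion. -/
theorem card_missingColor_ne_le_fetchCost [Fintype G] [Finite Y] {π' : G → Option (G ⊕ W)}
    (hS : ∀ e ∈ L.graph π, S.Holds e) (hT : ∀ e ∈ L.graph π', T.Holds e) :
    (Finset.univ.filter fun g => L.missingColor S g ≠ L.missingColor T g).card ≤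
      S.fetchCost T := by
  have hins : ∀ g, L.missingColor S g ≠ L.missingColor T g → ∃ d,
      L.gadgetEdge g 0 d ∈ T.matching (L.missingColor S g) \ S.matching (L.missingColor S g) := by
    intro g hg
    by_contra! hcon
    refine hg ((missingColor_spec hT g _).1.1 fun d hd hmem => hcon d ?_)
    exact Finset.mem_sdiff.2 ⟨hmem, (missingColor_spec hS g _).1.2 rfl d hd⟩
  choose! d hd using hins
  have hsigma : S.fetchCost T =
      ((Finset.univ : Finset (Fin k)).sigma fun i => T.matching i \ S.matching i).card := by
    rw [Finset.card_sigma]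
    rfl
  rw [hsigma]
  refine Finset.card_le_card_of_injOn
    (fun g => ⟨L.missingColor S g, L.gadgetEdge g 0 (d g)⟩) ?_ ?_
  · intro g hg
    have hg' : L.missingColor S g ≠ L.missingColor T g := by simpa using hg
    simpa using hd g hg'
  · intro g _ g' _ h
    have h₁ : L.gadgetEdge g 0 (d g) = L.gadgetEdge g' 0 (d g') := by
      have := (Sigma.mk.inj h).2
      exact eq_of_heq this
    have h₂ := (Prod.mk.inj h₁).1
    rw [L.place.injective.eq_iff] at h₂
    exact (Prod.mk.inj (Sum.inl_injective h₂)).1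

end Settled

section ColoredCache

variable [DecidableEq Y] {π π' : G → Option (G ⊕ W)} {c c' : G → Fin k}

/-- The edge `e` belongs to the graph of a wiring, and it has the color `i` if the gadgets have the
missing colors `c`. -/
def HasColor (π : G → Option (G ⊕ W)) (c : G → Fin k) (i : Fin k) (e : Edge n) : Prop :=
  (∃ g x d, ¬ (x = 0 ∧ d = 0) ∧ L.edgeColor (c g) x d = i ∧ e = L.gadgetEdge g x d) ∨
    ∃ g z, π g = some z ∧ c g = i ∧ e = L.wireEdge g z

theorem gadgetEdge_disjoint_wireEdge (h : Compatible π c) {i : Fin k} {g : G} {x : Y} {d : Fin k}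
    (hx : ¬ (x = 0 ∧ d = 0)) (hi : L.edgeColor (c g) x d = i) {g' : G} {z : G ⊕ W}
    (hz : π g' = some z) (hi' : c g' = i) :
    ¬ ((L.gadgetEdge g x d).1 = (L.wireEdge g' z).1 ∨
      (L.gadgetEdge g x d).2 = (L.wireEdge g' z).2) := by
  rintro (h₁ | h₂)
  · have h₃ := Prod.mk.inj (Sum.inl_injective (L.place.injective h₁))
    obtain ⟨rfl, rfl⟩ := h₃
    rw [← hi', L.edgeColor_zero_eq_iff] at hi
    exact hx ⟨rfl, hi⟩
  · obtain ⟨rfl, h₃⟩ := L.target_eq_iff.1 h₂.symm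
    rw [← L.edgeColor_add_shift, h₃, ← hi', ← h.link hz, L.edgeColor_zero_eq_iff] at hi
    rw [hi, L.shift_zero, add_zero] at h₃
    exact hx ⟨h₃, hi⟩

open Classical in
/-- The cache that holds the graph of a wiring, with given missing colors of the gadgets. -/
noncomputable def coloredCache (h : Compatible π c) : Cache n k where
  matching i := Finset.univ.filter (L.HasColor π c i)
  isMatching := by
    intro i e he f hf hef
    rw [Finset.mem_filter_univ] at he hf
    rcases he with ⟨g, x, d, hx, hi, rfl⟩ | ⟨g, z, hz, hi, rfl⟩ <;>
      rcases hf with ⟨g', x', d', hx', hi', rfl⟩ | ⟨g', z', hz', hi', rfl⟩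
    · rcases hef with h₁ | h₂
      · obtain ⟨rfl, rfl⟩ := Prod.mk.inj (Sum.inl_injective (L.place.injective h₁))
        rw [(L.edgeColor (c g) x).injective (hi.trans hi'.symm)]
      · obtain ⟨rfl, h₃⟩ := Prod.mk.inj (Sum.inl_injective (L.place.injective h₂))
        rw [← L.edgeColor_add_shift] at hi hi'
        rw [← h₃] at hi'
        obtain rfl := (L.edgeColor (c g) _).injective (hi.trans hi'.symm)
        rw [add_right_cancel h₃]
    · exact absurd hef (L.gadgetEdge_disjoint_wireEdge h hx hi hz' hi')
    · exact absurd (hef.imp Eq.symm Eq.symm) (L.gadgetEdge_disjoint_wireEdge h hx' hi' hz hi)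
    · rcases hef with h₁ | h₂
      · obtain ⟨rfl, -⟩ := Prod.mk.inj (Sum.inl_injective (L.place.injective h₁))
        rw [Option.some_injective _ (hz.symm.trans hz')]
      · obtain rfl := L.target_injective h₂
        rw [h.inj hz hz' (hi.trans hi'.symm)]

theorem mem_coloredCache (h : Compatible π c) {i : Fin k} {e : Edge n} :
    e ∈ (L.coloredCache h).matching i ↔ L.HasColor π c i e := by
  simp [coloredCache]

theorem coloredCache_holds (h : Compatible π c) {e : Edge n} (he : e ∈ L.graph π) :
    (L.coloredCache h).Holds e := by
  simp only [graph, Finset.mem_filter_univ] at he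
  rcases he with ⟨g, x, d, hx, rfl⟩ | ⟨g, z, hz, rfl⟩
  · exact ⟨_, (L.mem_coloredCache h).2 (.inl ⟨g, x, d, hx, rfl, rfl⟩)⟩
  · exact ⟨_, (L.mem_coloredCache h).2 (.inr ⟨g, z, hz, rfl, rfl⟩)⟩

open Classical in
theorem card_edgeColor_ne_le [Fintype G] [Fintype Y] (c c' : G → Fin k) :
    (Finset.univ.filter fun t : G × Y × Fin k =>
      L.edgeColor (c t.1) t.2.1 t.2.2 ≠ L.edgeColor (c' t.1) t.2.1 t.2.2).card ≤
      (Finset.univ.filter fun g => c g ≠ c' g).card * 9 := by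
  refine (Finset.card_le_card (t := (Finset.univ.filter fun g => c g ≠ c' g).biUnion fun g =>
    {g} ×ˢ ({0, L.shift (c g), L.shift (c' g)} ×ˢ {0, c g, c' g})) ?_).trans
    (Finset.card_biUnion_le_card_mul _ _ _ fun g _ => ?_)
  · rintro ⟨g, x, d⟩ ht
    rw [Finset.mem_filter_univ] at ht
    rw [Finset.mem_biUnion]
    refine ⟨g, ?_, Finset.mem_product.2 ⟨Finset.mem_singleton_self g,
      Finset.mem_product.2 (L.mem_of_edgeColor_ne ht)⟩⟩
    rw [Finset.mem_filter_univ]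
    intro hg
    exact ht (by rw [hg])
  -- three left nodes, three displacements
  · rw [Finset.card_product, Finset.card_product, Finset.card_singleton, one_mul]
    exact Nat.mul_le_mul Finset.card_le_three Finset.card_le_three

open Classical in
/-- Recoloring a gadget takes a bounded number of insertions, and a new wire takes one. -/
theorem fetchCost_coloredCache_le [Fintype G] [Fintype Y] (h : Compatible π c)
    (h' : Compatible π' c') :
    (L.coloredCache h).fetchCost (L.coloredCache h') ≤
      (Finset.univ.filter fun g => c g ≠ c' g).card * 9 +
        (Finset.univ.filter fun g => c g ≠ c' g ∨ π g ≠ π' g).card := by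
  set P : Finset (G × Y × Fin k) := Finset.univ.filter fun t =>
    L.edgeColor (c t.1) t.2.1 t.2.2 ≠ L.edgeColor (c' t.1) t.2.1 t.2.2 with hP
  set Q : Finset G := Finset.univ.filter fun g => c g ≠ c' g ∨ π g ≠ π' g with hQ
  have hsub : ∀ i, (L.coloredCache h').matching i \ (L.coloredCache h).matching i ⊆
      (P.filter fun t => L.edgeColor (c' t.1) t.2.1 t.2.2 = i).image
        (fun t => L.gadgetEdge t.1 t.2.1 t.2.2) ∪
      (Q.filter fun g => c' g = i).image
        fun g => (π' g).elim (L.gadgetEdge g 0 0) (L.wireEdge g) := by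
    intro i e he
    rw [Finset.mem_sdiff, L.mem_coloredCache, L.mem_coloredCache] at he
    rw [Finset.mem_union, Finset.mem_image, Finset.mem_image]
    obtain ⟨he, hne⟩ := he
    rcases he with ⟨g, x, d, hx, hi, rfl⟩ | ⟨g, z, hz, hi, rfl⟩
    · left
      refine ⟨(g, x, d), Finset.mem_filter.2 ⟨?_, hi⟩, rfl⟩
      rw [hP, Finset.mem_filter_univ]
      intro heq
      exact hne (.inl ⟨g, x, d, hx, heq.trans hi, rfl⟩)
    · right
      refine ⟨g, Finset.mem_filter.2 ⟨?_, hi⟩, by rw [hz]; rfl⟩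
      rw [hQ, Finset.mem_filter_univ]
      by_contra! hcon
      exact hne (.inr ⟨g, z, hcon.2.trans hz, hcon.1.trans hi, rfl⟩)
  calc (L.coloredCache h).fetchCost (L.coloredCache h')
      ≤ ∑ i, ((P.filter fun t => L.edgeColor (c' t.1) t.2.1 t.2.2 = i).card +
          (Q.filter fun g => c' g = i).card) :=
        Finset.sum_le_sum fun i _ => (Finset.card_le_card (hsub i)).trans
          ((Finset.card_union_le _ _).trans
            (Nat.add_le_add Finset.card_image_le Finset.card_image_le))
    _ = P.card + Q.card := by
        rw [Finset.sum_add_distrib,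
          ← Finset.card_eq_sum_card_fiberwise fun _ _ => Finset.mem_coe.2 (Finset.mem_univ _),
          ← Finset.card_eq_sum_card_fiberwise fun _ _ => Finset.mem_coe.2 (Finset.mem_univ _)]
    _ ≤ _ := Nat.add_le_add_right (L.card_edgeColor_ne_le c c') _

end ColoredCache

end Layout

end Wiring

/-! ### Translated labels -/

section Labels

variable {p : ℕ} {R : Type*}

/-- The labels of the gadgets in a layer: bit vectors of length `p`, and some further labels. -/
abbrev Label (p : ℕ) (R : Type*) : Type _ := (Fin p → ZMod 2) ⊕ R

theorem add_self_bits (v : Fin p → ZMod 2) : v + v = 0 :=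
  funext fun _ => CharTwo.add_self_eq_zero _

/-- Translation by a bit vector; it fixes the labels that are not bit vectors. -/
def translate (v : Fin p → ZMod 2) : Equiv.Perm (Label p R) :=
  (Equiv.addRight v).sumCongr (Equiv.refl R)

theorem translate_translate (v w : Fin p → ZMod 2) (i : Label p R) :
    translate v (translate w i) = translate (w + v) i := by
  rcases i with z | i
  · simp [translate, add_assoc]
  · simp [translate]

/-- The labels whose bit with index `r` is `β`. -/
def HasBit (r : Fin p) (β : ZMod 2) (i : Label p R) : Prop := ∃ z, i = .inl z ∧ z r = β

theorem HasBit.unique {r : Fin p} {β β' : ZMod 2} {i : Label p R} (h : HasBit r β i)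
    (h' : HasBit r β' i) : β = β' := by
  obtain ⟨z, rfl, rfl⟩ := h
  obtain ⟨z', hz, rfl⟩ := h'
  rw [Sum.inl_injective hz]

theorem HasBit.translate {r : Fin p} {β : ZMod 2} {i : Label p R} (h : HasBit r β i)
    (v : Fin p → ZMod 2) : HasBit r (β + v r) (translate v i) := by
  obtain ⟨z, rfl, rfl⟩ := h
  exact ⟨z + v, rfl, rfl⟩

open Classical in
theorem two_pow_le_two_mul_card_hasBit [Fintype R] (r : Fin p) :
    2 ^ p ≤ 2 * (Finset.univ.filter fun i : Label p R => HasBit r 0 i).card := by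
  have hsub : (Finset.univ : Finset (Fin p → ZMod 2)).map Function.Embedding.inl ⊆
      (Finset.univ.filter fun i : Label p R => HasBit r 0 i) ∪
        (Finset.univ.filter fun i : Label p R => HasBit r 0 i).image
          (translate (Pi.single r 1)) := by
    intro i hi
    obtain ⟨z, -, rfl⟩ := Finset.mem_map.1 hi
    rw [Finset.mem_union, Finset.mem_image]
    have h01 : ∀ y : ZMod 2, y = 0 ∨ y + 1 = 0 := by decide
    rcases h01 (z r) with h | h
    · exact .inl (Finset.mem_filter.2 ⟨Finset.mem_univ _, z, rfl, h⟩)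
    · refine .inr ⟨.inl (z + Pi.single r 1), Finset.mem_filter.2 ⟨Finset.mem_univ _, _, rfl, ?_⟩, ?_⟩
      · simpa using h
      · simp [translate, add_assoc, add_self_bits]
  have h := (Finset.card_le_card hsub).trans (Finset.card_union_le _ _)
  have h' := Finset.card_image_le (s := Finset.univ.filter fun i : Label p R => HasBit r 0 i)
    (f := translate (Pi.single r 1))
  rw [Finset.card_map, Finset.card_univ, Fintype.card_fun, ZMod.card, Fintype.card_fin] at h
  omega

open Classical in
/-- Let two families of labels be colored injectively, by `s` and `s'`. If the colors of the labels
of the first family with bit `0` have to become disjoint from those of the labels of the second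
family without bit `β`, then many labels change their color for `β = 0` or for `β = 1`: the label
with bit `0` of the first family whose color is `s' i'` is in conflict with `i'` in one of the two
cases, since `i'` cannot have both bits. -/
theorem card_hasBit_le_changes {k : ℕ} [Fintype R] (hcard : Fintype.card (Label p R) = k)
    (r : Fin p) {s s' t₀ t₀' t₁ t₁' : Label p R → Fin k} (hs : Function.Injective s)
    (hs' : Function.Injective s')
    (h₀ : ∀ i i', HasBit r 0 i → ¬ HasBit r 0 i' → t₀ i ≠ t₀' i')
    (h₁ : ∀ i i', HasBit r 0 i → ¬ HasBit r 1 i' → t₁ i ≠ t₁' i') :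
    (Finset.univ.filter fun i : Label p R => HasBit r 0 i).card ≤
      (Finset.univ.filter fun i => s i ≠ t₀ i).card +
        (Finset.univ.filter fun i => s' i ≠ t₀' i).card +
      ((Finset.univ.filter fun i => s i ≠ t₁ i).card +
        (Finset.univ.filter fun i => s' i ≠ t₁' i).card) := by
  have hbij : Function.Bijective s' :=
    (Fintype.bijective_iff_injective_and_card s').2 ⟨hs', by rw [hcard, Fintype.card_fin]⟩
  choose τ hτ using fun i => hbij.2 (s i)
  have hinj : Function.Injective τ := fun i i' h => hs (by rw [← hτ, ← hτ, h])
  have hpre : ∀ t : Label p R → Fin k,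
      (Finset.univ.filter fun i => s' (τ i) ≠ t (τ i)).card ≤
        (Finset.univ.filter fun i => s' i ≠ t i).card := fun t =>
    Finset.card_le_card_of_injOn τ (fun i hi => by simpa using hi) hinj.injOn
  have hsub : (Finset.univ.filter fun i : Label p R => HasBit r 0 i) ⊆
      ((Finset.univ.filter fun i => s i ≠ t₀ i) ∪
        (Finset.univ.filter fun i => s' (τ i) ≠ t₀' (τ i))) ∪
      ((Finset.univ.filter fun i => s i ≠ t₁ i) ∪
        (Finset.univ.filter fun i => s' (τ i) ≠ t₁' (τ i))) := by
    intro i hi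
    simp only [Finset.mem_union, Finset.mem_filter_univ] at hi ⊢
    by_contra! hcon
    obtain ⟨⟨e₁, e₂⟩, e₃, e₄⟩ := hcon
    have b₀ : HasBit r 0 (τ i) := by
      by_contra hb
      exact h₀ i (τ i) hi hb (by rw [← e₁, ← e₂, hτ])
    have b₁ : HasBit r 1 (τ i) := by
      by_contra hb
      exact h₁ i (τ i) hi hb (by rw [← e₃, ← e₄, hτ])
    exact absurd (b₀.unique b₁) (by decide)
  refine (Finset.card_le_card hsub).trans ((Finset.card_union_le _ _).trans ?_)
  refine Nat.add_le_add ((Finset.card_union_le _ _).trans ?_) ((Finset.card_union_le _ _).trans ?_)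
  · exact Nat.add_le_add_left (hpre t₀') _
  · exact Nat.add_le_add_left (hpre t₁') _

end Labels

/-! ### Offsets of layers -/

section Offsets

variable {p : ℕ}

/-- The offset of the layer `a` by the vectors of the levels below `j`: the vector `x h` of the
level `h` counts if the binary digit of `a` with index `h` is one. In characteristic two the
quotient `a / 2 ^ h` may be used in place of this digit. -/
def offset (x : ℕ → Fin p → ZMod 2) (j a : ℕ) : Fin p → ZMod 2 :=
  ∑ h ∈ Finset.range j, (a / 2 ^ h) • x h

theorem offset_congr {x x' : ℕ → Fin p → ZMod 2} {j : ℕ} (hx : ∀ h < j, x h = x' h) (a : ℕ) :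
    offset x j a = offset x' j a :=
  Finset.sum_congr rfl fun h hh => by rw [hx h (Finset.mem_range.1 hh)]

/-- The relative offset of two neighboring layers in the same block of `2 ^ j` layers depends on
the vectors of the levels below `j` only. -/
theorem offset_add_offset_succ (x : ℕ → Fin p → ZMod 2) {j h a : ℕ} (hjh : j ≤ h)
    (ha : ¬ 2 ^ j ∣ a + 1) :
    offset x h a + offset x h (a + 1) = offset x j a + offset x j (a + 1) := by
  induction h, hjh using Nat.le_induction with
  | base => rfl
  | succ h hjh ih =>
    have hh : ¬ 2 ^ h ∣ a + 1 := fun hd => ha ((pow_dvd_pow 2 hjh).trans hd)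
    rw [← ih, offset, offset, Finset.sum_range_succ, Finset.sum_range_succ, Nat.succ_div,
      if_neg hh, add_zero, add_add_add_comm, add_self_bits, add_zero]
    rfl

/-- The relative offset of the last layers of two neighboring blocks of `2 ^ j` layers. -/
theorem offset_add_offset_block (x : ℕ → Fin p → ZMod 2) {j h a : ℕ} (hjh : j < h)
    (ha : 2 ^ (j + 1) ∣ a + 1) : offset x h (a - 2 ^ j) + offset x h a = x j := by
  obtain ⟨t, ht⟩ := ha
  obtain ⟨t, rfl⟩ : ∃ u, t = u + 1 := Nat.exists_eq_succ_of_ne_zero (by rintro rfl; omega)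
  have hj : 0 < 2 ^ j := by positivity
  obtain ⟨e, rfl⟩ : ∃ e, a = e + 2 ^ j := ⟨a - 2 ^ j, by rw [pow_succ] at ht; lia⟩
  have he : e + 1 = 2 ^ (j + 1) * t + 2 ^ j := by rw [pow_succ] at ht ⊢; lia
  rw [Nat.add_sub_cancel]
  unfold offset
  rw [← Finset.sum_add_distrib, Finset.sum_eq_single_of_mem j (Finset.mem_range.2 hjh)]
  · rw [Nat.add_div_right _ hj, succ_nsmul, ← add_assoc, add_self_bits, zero_add]
  · intro i _ hij
    rcases Nat.lt_or_gt_of_ne hij with h | h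
    · obtain ⟨u, rfl⟩ := Nat.exists_eq_add_of_lt h
      have h2 : 2 ^ (i + u + 1) = 2 ^ (u + 1) * 2 ^ i := by ring
      rw [h2, Nat.add_mul_div_right _ _ (by positivity), add_nsmul, ← add_assoc, add_self_bits,
        zero_add, pow_succ, mul_nsmul, two_nsmul, add_self_bits]
    · obtain ⟨u, rfl⟩ := Nat.exists_eq_add_of_lt h
      have h2 : 2 ^ (j + u + 1) = 2 ^ (j + 1) * 2 ^ u := by ring
      have e₁ : e / 2 ^ (j + 1) = t :=
        Nat.div_eq_of_lt_le (by rw [mul_comm]; omega) (by rw [mul_comm]; lia)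
      have e₂ : (e + 2 ^ j) / 2 ^ (j + 1) = t :=
        Nat.div_eq_of_lt_le (by rw [mul_comm]; omega) (by rw [mul_comm]; omega)
      rw [h2, ← Nat.div_div_eq_div_mul, ← Nat.div_div_eq_div_mul, e₁, e₂, add_self_bits]

end Offsets

/-! ### The wirings of the adversary -/

section Wirings

variable {p H : ℕ} {R : Type*}

/-- The layer after `a`, cyclically. -/
def next (a : Fin (2 ^ H)) : Fin (2 ^ H) := ⟨(a + 1) % 2 ^ H, Nat.mod_lt _ (by positivity)⟩

theorem not_dvd_lt {j : ℕ} (hj : j ≤ H) {a : Fin (2 ^ H)} (ha : ¬ 2 ^ j ∣ (a : ℕ) + 1) :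
    (a : ℕ) + 1 < 2 ^ H := by
  refine lt_of_le_of_ne a.isLt fun h => ha ?_
  rw [h]
  exact pow_dvd_pow 2 hj

/-- The gadget in the next layer to which a gadget is joined within a block of level `j`. -/
def link (x : ℕ → Fin p → ZMod 2) (j : ℕ) (g : Fin (2 ^ H) × Label p R) :
    Fin (2 ^ H) × Label p R :=
  (next g.1, translate (offset x j g.1 + offset x j (g.1 + 1)) g.2)

/-- The layers of each block of `2 ^ j` layers are joined in sequence, and the gadgets of its last
layer are joined to a hub, which makes their colors distinct. -/
def baseWiring (x : ℕ → Fin p → ZMod 2) (j : ℕ) (g : Fin (2 ^ H) × Label p R) :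
    Option ((Fin (2 ^ H) × Label p R) ⊕ Fin (2 ^ H)) :=
  if 2 ^ j ∣ (g.1 : ℕ) + 1 then some (.inr g.1) else some (.inl (link x j g))

open Classical in
/-- The layers of each block of `2 ^ j` layers are joined in sequence. For each pair of neighboring
blocks, a hub is joined to the gadgets in the last layer of the first block whose label has the bit
`0`, and to those in the last layer of the second block whose label does not have the bit `β`. -/
noncomputable def testWiring (x : ℕ → Fin p → ZMod 2) (j : ℕ) (r : Fin p) (β : ZMod 2)
    (g : Fin (2 ^ H) × Label p R) : Option ((Fin (2 ^ H) × Label p R) ⊕ Fin (2 ^ H)) :=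
  if 2 ^ (j + 1) ∣ (g.1 : ℕ) + 1 then
    if HasBit r β g.2 then none
    else some (.inr ⟨g.1 - 2 ^ j, (Nat.sub_le _ _).trans_lt g.1.isLt⟩)
  else if 2 ^ j ∣ (g.1 : ℕ) + 1 then
    if HasBit r 0 g.2 then some (.inr g.1) else none
  else some (.inl (link x j g))

theorem link_congr {x x' : ℕ → Fin p → ZMod 2} {j : ℕ} (hx : ∀ h < j, x h = x' h) :
    (link x j : Fin (2 ^ H) × Label p R → _) = link x' j := by
  funext g
  rw [link, link, offset_congr hx, offset_congr hx]

theorem baseWiring_congr {x x' : ℕ → Fin p → ZMod 2} {j : ℕ} (hx : ∀ h < j, x h = x' h) :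
    (baseWiring x j : Fin (2 ^ H) × Label p R → _) = baseWiring x' j := by
  funext g
  rw [baseWiring, baseWiring, link_congr hx]

theorem testWiring_congr {x x' : ℕ → Fin p → ZMod 2} {j : ℕ} (hx : ∀ h < j, x h = x' h) :
    (testWiring x j : Fin p → ZMod 2 → Fin (2 ^ H) × Label p R → _) = testWiring x' j := by
  funext r β g
  rw [testWiring, testWiring, link_congr hx]

theorem baseWiring_of_not_dvd {x : ℕ → Fin p → ZMod 2} {j : ℕ} {g : Fin (2 ^ H) × Label p R}
    (hg : ¬ 2 ^ j ∣ (g.1 : ℕ) + 1) : baseWiring x j g = some (.inl (link x j g)) :=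
  if_neg hg

theorem testWiring_of_not_dvd {x : ℕ → Fin p → ZMod 2} {j : ℕ} {r : Fin p} {β : ZMod 2}
    {g : Fin (2 ^ H) × Label p R} (hg : ¬ 2 ^ j ∣ (g.1 : ℕ) + 1) :
    testWiring x j r β g = some (.inl (link x j g)) := by
  rw [testWiring, if_neg fun h => hg ((pow_dvd_pow 2 (Nat.le_succ j)).trans h), if_neg hg]

theorem link_eq_link_of_le (x : ℕ → Fin p → ZMod 2) {j h : ℕ} (hjh : j ≤ h)
    {g : Fin (2 ^ H) × Label p R} (hg : ¬ 2 ^ j ∣ (g.1 : ℕ) + 1) : link x h g = link x j g := by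
  rw [link, link, offset_add_offset_succ x hjh hg]

/-! ### The offline coloring -/

variable {k : ℕ}

/-- The coloring of the offline algorithm: labels are translated by the offsets of the layers. -/
def offlineColor (E : Label p R ≃ Fin k) (x : ℕ → Fin p → ZMod 2) (g : Fin (2 ^ H) × Label p R) :
    Fin k :=
  E (translate (offset x H g.1) g.2)

variable (E : Label p R ≃ Fin k) (x : ℕ → Fin p → ZMod 2) {j : ℕ}

theorem offlineColor_link (hj : j ≤ H) {g : Fin (2 ^ H) × Label p R}
    (hg : ¬ 2 ^ j ∣ (g.1 : ℕ) + 1) : offlineColor E x (link x j g) = offlineColor E x g := by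
  have hlt := not_dvd_lt hj hg
  have hn : ((next g.1 : Fin (2 ^ H)) : ℕ) = g.1 + 1 := Nat.mod_eq_of_lt hlt
  rw [← link_eq_link_of_le x hj hg]
  simp only [offlineColor, link, hn, translate_translate]
  rw [add_assoc, add_self_bits, add_zero]

theorem offlineColor_injective_layer {a : Fin (2 ^ H)} {i i' : Label p R}
    (h : offlineColor E x (a, i) = offlineColor E x (a, i')) : i = i' :=
  (translate _).injective (E.injective h)

theorem link_injective (hj : j ≤ H) {g g' : Fin (2 ^ H) × Label p R}
    (hg : ¬ 2 ^ j ∣ (g.1 : ℕ) + 1) (hg' : ¬ 2 ^ j ∣ (g'.1 : ℕ) + 1) (h : link x j g = link x j g') :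
    g = g' := by
  obtain ⟨a, i⟩ := g
  obtain ⟨a', i'⟩ := g'
  obtain ⟨h₁, h₂⟩ := Prod.mk.inj h
  dsimp only at h₁ h₂ hg hg'
  have h₃ : ((a : ℕ) + 1) % 2 ^ H = ((a' : ℕ) + 1) % 2 ^ H := congrArg Fin.val h₁
  rw [Nat.mod_eq_of_lt (not_dvd_lt hj hg), Nat.mod_eq_of_lt (not_dvd_lt hj hg')] at h₃
  obtain rfl : a = a' := Fin.ext (by omega)
  rw [(translate _).injective h₂]

theorem compatible_baseWiring (hj : j ≤ H) :
    Compatible (baseWiring x j) (offlineColor E x : Fin (2 ^ H) × Label p R → Fin k) where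
  link := by
    intro g h hg
    by_cases hd : 2 ^ j ∣ (g.1 : ℕ) + 1
    · rw [baseWiring, if_pos hd] at hg
      cases hg
    · rw [baseWiring_of_not_dvd hd] at hg
      cases hg
      exact offlineColor_link E x hj hd
  inj := by
    rintro ⟨a, i⟩ ⟨a', i'⟩ z hg hg' hc
    by_cases hd : 2 ^ j ∣ (a : ℕ) + 1 <;> by_cases hd' : 2 ^ j ∣ (a' : ℕ) + 1
    · rw [baseWiring, if_pos hd] at hg
      rw [baseWiring, if_pos hd'] at hg'
      cases hg
      cases hg'
      rw [offlineColor_injective_layer E x hc]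
    · rw [baseWiring, if_pos hd] at hg
      rw [baseWiring_of_not_dvd hd'] at hg'
      cases hg
      cases hg'
    · rw [baseWiring_of_not_dvd hd] at hg
      rw [baseWiring, if_pos hd'] at hg'
      cases hg
      cases hg'
    · rw [baseWiring_of_not_dvd hd] at hg
      rw [baseWiring_of_not_dvd hd'] at hg'
      rw [← hg'] at hg
      exact link_injective x hj hd hd' (Sum.inl_injective (Option.some_injective _ hg))

/-- The offline coloring passes the tests, because the last layers of two neighboring blocks of
level `j` differ by a translation by `x j`. -/
theorem compatible_testWiring (hj : j < H) (r : Fin p) :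
    Compatible (testWiring x j r (x j r))
      (offlineColor E x : Fin (2 ^ H) × Label p R → Fin k) where
  link := by
    intro g h hg
    by_cases hd : 2 ^ j ∣ (g.1 : ℕ) + 1
    · rw [testWiring] at hg
      split_ifs at hg <;> cases hg
    · rw [testWiring_of_not_dvd hd] at hg
      cases hg
      exact offlineColor_link E x hj.le hd
  inj := by
    -- a gadget with bit `0` and one without bit `x j r` get different colors at a common hub
    have key : ∀ {a a' : Fin (2 ^ H)} {i i' : Label p R}, 2 ^ (j + 1) ∣ (a' : ℕ) + 1 →
        HasBit r 0 i → ¬ HasBit r (x j r) i' → (a : ℕ) = a' - 2 ^ j →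
        offlineColor E x (a, i) ≠ offlineColor E x (a', i') := by
      intro a a' i i' hd hi hi' ha hc
      have h₁ : translate (offset x H a) i = translate (offset x H a') i' := E.injective hc
      have h₂ : i' = translate (x j) i := by
        rw [← offset_add_offset_block x hj hd, ← translate_translate, ← ha, h₁,
          translate_translate, add_self_bits]
        rcases i' with z | i' <;> simp [translate]
      refine hi' ?_
      rw [h₂]
      simpa using hi.translate (x j)
    rintro ⟨a, i⟩ ⟨a', i'⟩ z hg hg' hc
    by_cases hd : 2 ^ j ∣ (a : ℕ) + 1 <;> by_cases hd' : 2 ^ j ∣ (a' : ℕ) + 1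
    · have hj0 : 0 < 2 ^ j := by positivity
      rw [testWiring] at hg hg'
      split_ifs at hg with h₁ h₂ h₂ <;> split_ifs at hg' with h₃ h₄ h₄ <;> cases hg <;>
        injection hg' with hg' <;> injection hg' with hg'
      · have hle : ∀ b : Fin (2 ^ H), 2 ^ (j + 1) ∣ (b : ℕ) + 1 → 2 ^ j ≤ (b : ℕ) := by
          intro b hb
          have := Nat.le_of_dvd (Nat.succ_pos _) hb
          rw [pow_succ] at this
          omega
        have h₅ := congrArg Fin.val hg'
        have h₆ := hle a h₁
        have h₇ := hle a' h₃
        dsimp only at h₅ h₆ h₇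
        obtain rfl : a = a' := Fin.ext (by omega)
        rw [offlineColor_injective_layer E x hc]
      · exact absurd hc.symm (key h₁ h₄ h₂ (congrArg Fin.val hg'))
      · exact absurd hc (key h₃ h₂ h₄ (congrArg Fin.val hg'.symm))
      · subst hg'
        rw [offlineColor_injective_layer E x hc]
    · rw [testWiring_of_not_dvd hd'] at hg'
      cases hg'
      rw [testWiring] at hg
      split_ifs at hg <;> cases hg
    · rw [testWiring_of_not_dvd hd] at hg
      cases hg
      rw [testWiring] at hg'
      split_ifs at hg' <;> cases hg'
    · rw [testWiring_of_not_dvd hd] at hg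
      rw [testWiring_of_not_dvd hd'] at hg'
      rw [← hg'] at hg
      exact link_injective x hj.le hd hd' (Sum.inl_injective (Option.some_injective _ hg))

end Wirings

/-! ### The number of gadgets that change their color -/

section Changes

theorem mul_le_sum_range_of_blocks {F : ℕ → ℕ} {q m T : ℕ}
    (h : ∀ t < T, m ≤ ∑ s ∈ Finset.range q, F (q * t + s)) :
    T * m ≤ ∑ a ∈ Finset.range (q * T), F a := by
  induction T with
  | zero => simp
  | succ T ih =>
    rw [mul_add, mul_one, Finset.sum_range_add, add_mul, one_mul]
    exact Nat.add_le_add (ih fun t ht => h t (by omega)) (h T (by omega))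

/-- A function that is constant on the blocks of `2 ^ j` layers and whose values on two neighboring
blocks add up to at least `m` is at least `m / 2` on average. -/
theorem two_pow_mul_le_two_mul_sum {H j m : ℕ} (hj : j < H) {D : Fin (2 ^ H) → ℕ}
    (hD : ∀ a : Fin (2 ^ H), ¬ 2 ^ j ∣ (a : ℕ) + 1 → D a = D (next a))
    (hpair : ∀ a e : Fin (2 ^ H), 2 ^ (j + 1) ∣ (a : ℕ) + 1 → (e : ℕ) = a - 2 ^ j →
      m ≤ D e + D a) :
    2 ^ H * m ≤ 2 * ∑ a, D a := by
  obtain ⟨u, rfl⟩ := Nat.exists_eq_add_of_lt hj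
  have hpow : 2 ^ (j + u + 1) = 2 ^ (j + 1) * 2 ^ u := by ring
  have hsucc : 2 ^ (j + 1) = 2 ^ j + 2 ^ j := by ring
  have hj0 : 0 < 2 ^ j := by positivity
  set F : ℕ → ℕ := fun a => if h : a < 2 ^ (j + u + 1) then D ⟨a, h⟩ else 0 with hF
  have hFa : ∀ a (h : a < 2 ^ (j + u + 1)), F a = D ⟨a, h⟩ := fun a h => dif_pos h
  have hsum : ∑ a, D a = ∑ a ∈ Finset.range (2 ^ (j + u + 1)), F a := by
    rw [Finset.sum_range]
    exact Finset.sum_congr rfl fun a _ => (hFa a a.isLt).symm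
  have hconst : ∀ t s, s < 2 ^ j → 2 ^ j * t + 2 ^ j ≤ 2 ^ (j + u + 1) →
      F (2 ^ j * t + s) = F (2 ^ j * t) := by
    intro t s hs ht
    induction s with
    | zero => rfl
    | succ s ih =>
      rw [← ih (by omega)]
      have h₁ : 2 ^ j * t + s < 2 ^ (j + u + 1) := by omega
      have h₂ : 2 ^ j * t + (s + 1) < 2 ^ (j + u + 1) := by omega
      rw [hFa _ h₁, hFa _ h₂, hD ⟨_, h₁⟩]
      · congr 1
        exact Fin.ext (Nat.mod_eq_of_lt h₂).symm
      · intro hd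
        have h₃ : 2 ^ j ∣ 2 ^ j * t + (s + 1) := hd
        rw [Nat.dvd_add_right (Dvd.intro _ rfl)] at h₃
        exact absurd (Nat.le_of_dvd (Nat.succ_pos _) h₃) (by omega)
  have hblock : ∀ t < 2 ^ u, 2 ^ j * m ≤
      ∑ s ∈ Finset.range (2 ^ (j + 1)), F (2 ^ (j + 1) * t + s) := by
    intro t ht
    have hbound : 2 ^ (j + 1) * t + 2 ^ (j + 1) ≤ 2 ^ (j + u + 1) := by
      rw [hpow, ← Nat.mul_succ]
      exact Nat.mul_le_mul_left _ ht
    have e₀ : 2 ^ (j + 1) * t = 2 ^ j * (2 * t) := by ring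
    have e₁ : 2 ^ j * (2 * t + 1) = 2 ^ j * (2 * t) + 2 ^ j := by ring
    have s₀ : ∀ s ∈ Finset.range (2 ^ j), F (2 ^ j * (2 * t) + s) = F (2 ^ j * (2 * t)) :=
      fun s hs => hconst _ s (Finset.mem_range.1 hs) (by omega)
    have s₁ : ∀ s ∈ Finset.range (2 ^ j), F (2 ^ j * (2 * t) + (2 ^ j + s)) =
        F (2 ^ j * (2 * t + 1)) := by
      intro s hs
      rw [← add_assoc, ← e₁]
      exact hconst _ s (Finset.mem_range.1 hs) (by omega)
    rw [hsucc, Finset.sum_range_add, ← hsucc, e₀, Finset.sum_congr rfl s₀,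
      Finset.sum_congr rfl s₁, Finset.sum_const, Finset.sum_const, Finset.card_range, smul_eq_mul,
      smul_eq_mul, ← mul_add]
    refine Nat.mul_le_mul_left _ ?_
    rw [← hconst (2 * t) (2 ^ j - 1) (by omega) (by omega),
      ← hconst (2 * t + 1) (2 ^ j - 1) (by omega) (by omega), hFa _ (by omega), hFa _ (by omega)]
    refine hpair _ _ ⟨t + 1, ?_⟩ ?_
    · dsimp only
      rw [mul_add (2 ^ (j + 1)), mul_one]
      omega
    · dsimp only
      omega
  have := mul_le_sum_range_of_blocks hblock
  rw [← hpow, ← hsum] at this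
  calc 2 ^ (j + u + 1) * m = 2 * (2 ^ u * (2 ^ j * m)) := by ring
    _ ≤ _ := Nat.mul_le_mul_left _ this

variable {p H k : ℕ} {R : Type*} [Fintype R] {x : ℕ → Fin p → ZMod 2} {j : ℕ}

open Classical in
/-- The number of gadgets of a layer that get different colors in two colorings. -/
noncomputable def changes (c c' : Fin (2 ^ H) × Label p R → Fin k) (a : Fin (2 ^ H)) : ℕ :=
  (Finset.univ.filter fun i => c (a, i) ≠ c' (a, i)).card

open Classical in
theorem sum_changes (c c' : Fin (2 ^ H) × Label p R → Fin k) :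
    ∑ a, changes c c' a = (Finset.univ.filter fun g => c g ≠ c' g).card := by
  simp only [changes, Finset.card_filter]
  rw [Fintype.sum_prod_type]

theorem changes_next {c c' : Fin (2 ^ H) × Label p R → Fin k}
    {π π' : Fin (2 ^ H) × Label p R → Option ((Fin (2 ^ H) × Label p R) ⊕ Fin (2 ^ H))}
    (hc : Compatible π c) (hc' : Compatible π' c') {a : Fin (2 ^ H)}
    (hπ : ∀ i, π (a, i) = some (.inl (link x j (a, i))))
    (hπ' : ∀ i, π' (a, i) = some (.inl (link x j (a, i)))) :
    changes c c' a = changes c c' (next a) := by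
  refine Finset.card_equiv (translate (offset x j a + offset x j (a + 1))) fun i => ?_
  have h₁ := hc.link (hπ i)
  have h₂ := hc'.link (hπ' i)
  simp only [link] at h₁ h₂
  rw [Finset.mem_filter_univ, Finset.mem_filter_univ, h₁, h₂]

open Classical in
/-- If the gadgets have to be recolored from the base wiring of level `j` to the test wiring for a
bit, then a constant fraction of all the gadgets labeled by bit vectors changes its color for at
least one value of this bit. -/
theorem card_changes_ge (hcard : Fintype.card (Label p R) = k) (hj : j < H) (r : Fin p)
    {c c₀ c₁ : Fin (2 ^ H) × Label p R → Fin k} (hc : Compatible (baseWiring x j) c)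
    (hc₀ : Compatible (testWiring x j r 0) c₀) (hc₁ : Compatible (testWiring x j r 1) c₁) :
    2 ^ H * 2 ^ p ≤ 4 * ((Finset.univ.filter fun g => c g ≠ c₀ g).card +
      (Finset.univ.filter fun g => c g ≠ c₁ g).card) := by
  have hmain : 2 ^ H * (Finset.univ.filter fun i : Label p R => HasBit r 0 i).card ≤
      2 * ∑ a, (changes c c₀ a + changes c c₁ a) := by
    refine two_pow_mul_le_two_mul_sum hj (fun a ha => ?_) fun a e ha hea => ?_
    · rw [changes_next hc hc₀ (fun i => baseWiring_of_not_dvd ha)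
        (fun i => testWiring_of_not_dvd ha), changes_next hc hc₁
        (fun i => baseWiring_of_not_dvd ha) (fun i => testWiring_of_not_dvd ha)]
    · have hj0 : 0 < 2 ^ j := by positivity
      have ha0 : 2 ^ (j + 1) ≤ (a : ℕ) + 1 := Nat.le_of_dvd (Nat.succ_pos _) ha
      have hsucc : 2 ^ (j + 1) = 2 ^ j + 2 ^ j := by ring
      have hne : e ≠ a := fun h => by
        rw [h] at hea
        omega
      have ha' : 2 ^ j ∣ (a : ℕ) + 1 := (pow_dvd_pow 2 (Nat.le_succ j)).trans ha
      have hae : (a : ℕ) + 1 = (e : ℕ) + 1 + 2 ^ j := by omega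
      have he' : 2 ^ j ∣ (e : ℕ) + 1 := by
        rw [hae] at ha'
        exact (Nat.dvd_add_left dvd_rfl).1 ha'
      have he : ¬ 2 ^ (j + 1) ∣ (e : ℕ) + 1 := by
        intro h
        rw [hae] at ha
        have h₁ := Nat.le_of_dvd hj0 ((Nat.dvd_add_right h).1 ha)
        omega
      have hinj : ∀ b : Fin (2 ^ H), 2 ^ j ∣ (b : ℕ) + 1 →
          Function.Injective fun i => c (b, i) := by
        intro b hb i i' h
        have hi : ∀ i : Label p R, baseWiring x j (b, i) = some (.inr b) := fun i => if_pos hb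
        exact (Prod.mk.inj (hc.inj (hi i) (hi i') h)).2
      have htest : ∀ {c' : Fin (2 ^ H) × Label p R → Fin k} {β : ZMod 2},
          Compatible (testWiring x j r β) c' → ∀ i i', HasBit r 0 i → ¬ HasBit r β i' →
            c' (e, i) ≠ c' (a, i') := by
        intro c' β hc' i i' hi hi' h
        have h₁ : testWiring x j r β (e, i) = some (.inr e) := by
          rw [testWiring, if_neg he, if_pos he', if_pos hi]
        have h₂ : testWiring x j r β (a, i') = some (.inr e) := by
          rw [testWiring, if_pos ha, if_neg hi']
          congr 2
          exact Fin.ext hea.symm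
        exact hne (Prod.mk.inj (hc'.inj h₁ h₂ h)).1
      have := card_hasBit_le_changes hcard r (hinj e he') (hinj a ha') (htest hc₀) (htest hc₁)
      simp only [changes]
      omega
  rw [Finset.sum_add_distrib, sum_changes, sum_changes] at hmain
  calc 2 ^ H * 2 ^ p
      ≤ 2 ^ H * (2 * (Finset.univ.filter fun i : Label p R => HasBit r 0 i).card) :=
        Nat.mul_le_mul_left _ (two_pow_le_two_mul_card_hasBit r)
    _ = 2 * (2 ^ H * (Finset.univ.filter fun i : Label p R => HasBit r 0 i).card) := by ring
    _ ≤ _ := by omega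

open Classical in
theorem card_dvd_le (hcard : Fintype.card (Label p R) = k) (hj : j ≤ H) :
    (Finset.univ.filter fun g : Fin (2 ^ H) × Label p R => 2 ^ j ∣ (g.1 : ℕ) + 1).card ≤
      2 ^ (H - j) * k := by
  have h : (Finset.univ.filter fun g : Fin (2 ^ H) × Label p R => 2 ^ j ∣ (g.1 : ℕ) + 1) =
      (Finset.univ.filter fun a : Fin (2 ^ H) => 2 ^ j ∣ (a : ℕ) + 1) ×ˢ Finset.univ := by
    ext g
    simp
  rw [h, Finset.card_product, Finset.card_univ, hcard]
  refine Nat.mul_le_mul_right _ ?_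
  calc (Finset.univ.filter fun a : Fin (2 ^ H) => 2 ^ j ∣ (a : ℕ) + 1).card
      ≤ ((Finset.range (2 ^ H)).filter fun a => 2 ^ j ∣ a + 1).card :=
        Finset.card_le_card_of_injOn Fin.val
          (fun a ha => by simpa using ha) Fin.val_injective.injOn
    _ = 2 ^ (H - j) := by rw [Nat.card_multiples, Nat.pow_div hj (by norm_num)]

end Changes

/-! ### The phases of the adversary -/

section Phases

variable {p H k n : ℕ}

/-- The bits of the adversary, arranged into levels: below the level `j₀` all the vectors vanish,
and each further level takes the next `p` bits. -/
def levelBits (p j₀ : ℕ) (b : ℕ → ZMod 2) (j : ℕ) (r : Fin p) : ZMod 2 :=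
  if j < j₀ then 0 else b ((j - j₀) * p + r)

theorem levelBits_congr {j₀ t : ℕ} {b b' : ℕ → ZMod 2} (h : ∀ s < t, b s = b' s) :
    ∀ i < j₀ + t / p, levelBits p j₀ b i = levelBits p j₀ b' i := by
  intro i hi
  funext r
  unfold levelBits
  split_ifs with hij
  · rfl
  · refine h _ ?_
    have h₁ : (i - j₀ + 1) * p ≤ t / p * p := Nat.mul_le_mul_right _ (by omega)
    have h₂ := Nat.div_mul_le_self t p
    have h₃ := r.isLt
    rw [add_mul, one_mul] at h₁
    omega

theorem levelBits_apply [NeZero p] (j₀ : ℕ) (b : ℕ → ZMod 2) (t : ℕ) :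
    levelBits p j₀ b (j₀ + t / p) (Fin.ofNat p t) = b t := by
  unfold levelBits
  rw [if_neg (Nat.not_lt.2 (Nat.le_add_right _ _)), Nat.add_sub_cancel_left, Fin.val_ofNat, mul_comm, Nat.div_add_mod]

theorem sum_range_div [NeZero p] (f : ℕ → ℕ) (N : ℕ) :
    ∑ s ∈ Finset.range (N * p), f (s / p) = p * ∑ i ∈ Finset.range N, f i := by
  have hp := NeZero.pos p
  induction N with
  | zero => simp
  | succ N ih =>
    rw [add_mul, one_mul, Finset.sum_range_add, ih, Finset.sum_range_succ, mul_add]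
    congr 1
    rw [Finset.sum_congr rfl (g := fun _ => f N), Finset.sum_const, Finset.card_range, smul_eq_mul]
    intro s hs
    rw [mul_comm, Nat.mul_add_div hp, Nat.div_eq_of_lt (Finset.mem_range.1 hs), add_zero]

theorem sum_two_pow_sub_le (N : ℕ) : ∑ i ∈ Finset.range N, 2 ^ (N - i) ≤ 2 * 2 ^ N := by
  have : ∑ i ∈ Finset.range N, 2 ^ (N - i) + 2 = 2 * 2 ^ N := by
    induction N with
    | zero => rfl
    | succ N ih =>
      rw [Finset.sum_range_succ']
      simp only [Nat.add_sub_add_right, Nat.sub_zero]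
      rw [pow_succ]
      omega
  omega

variable [NeZero k] {R Y : Type*} [AddCommGroup Y]

/-- The requests in step `t`: the base wiring of the current level, then the test wiring for the
current bit of this level, both with the given number of rounds. -/
noncomputable def stepRequests [NeZero p] (L : Layout n k (Fin (2 ^ H) × Label p R) (Fin (2 ^ H)) Y)
    (j₀ m t : ℕ) (b : ℕ → ZMod 2) (β : ZMod 2) : List (Edge n) :=
  rounds (L.graph (baseWiring (levelBits p j₀ b) (j₀ + t / p))) m ++
    rounds (L.graph (testWiring (levelBits p j₀ b) (j₀ + t / p) (Fin.ofNat p t) β)) m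

variable (L : Layout n k (Fin (2 ^ H) × Label p R) (Fin (2 ^ H)) Y)

theorem stepRequests_congr [NeZero p] (j₀ m t : ℕ) (b b' : ℕ → ZMod 2) (h : ∀ s < t, b s = b' s) :
    stepRequests L j₀ m t b = stepRequests L j₀ m t b' := by
  funext β
  unfold stepRequests
  rw [baseWiring_congr (levelBits_congr h), testWiring_congr (levelBits_congr h)]

/-- The forced cost of a step is a quarter of the number of gadgets labeled by bit vectors. -/
theorem stepRequests_gain [NeZero p] [Fintype R] [Finite Y] (hcard : Fintype.card (Label p R) = k) {j₀ t : ℕ}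
    (ht : j₀ + t / p < H) (b : ℕ → ZMod 2) (A : OnlineAlgorithm n k) (σ : List (Edge n)) :
    2 * A.cost σ + 2 ^ H * 2 ^ p / 4 ≤
      A.cost (σ ++ stepRequests L j₀ (2 ^ H * 2 ^ p / 4) t b 0) +
        A.cost (σ ++ stepRequests L j₀ (2 ^ H * 2 ^ p / 4) t b 1) := by
  classical
  refine A.cost_fork _ _ _ _ (fun S T₀ T₁ hS hT₀ hT₁ => ?_) σ
  have h₀ := Layout.card_missingColor_ne_le_fetchCost hS hT₀
  have h₁ := Layout.card_missingColor_ne_le_fetchCost hS hT₁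
  have h₂ := card_changes_ge hcard ht _ (Layout.compatible_missingColor hS)
    (Layout.compatible_missingColor hT₀) (Layout.compatible_missingColor hT₁)
  omega

section Offline

variable [Fintype R] [DecidableEq Y] [Fintype Y] (E : Label p R ≃ Fin k)

open Classical in
theorem fetchCost_le_of_agree {π π' : Fin (2 ^ H) × Label p R →
      Option ((Fin (2 ^ H) × Label p R) ⊕ Fin (2 ^ H))} {c : Fin (2 ^ H) × Label p R → Fin k}
    (hcard : Fintype.card (Label p R) = k) {j : ℕ} (hj : j ≤ H) (h : Compatible π c)
    (h' : Compatible π' c) (hπ : ∀ g, ¬ 2 ^ j ∣ (g.1 : ℕ) + 1 → π g = π' g) :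
    (L.coloredCache h).fetchCost (L.coloredCache h') ≤ 2 ^ (H - j) * k := by
  refine (L.fetchCost_coloredCache_le h h').trans ?_
  have h₀ : (Finset.univ.filter fun g => c g ≠ c g).card = 0 := by simp
  rw [h₀, zero_mul, zero_add]
  refine (Finset.card_le_card fun g hg => ?_).trans (card_dvd_le hcard hj)
  simp only [Finset.mem_filter_univ] at hg ⊢
  by_contra hd
  exact hg.elim (fun hne => hne rfl) fun hne => hne (hπ g hd)

theorem fetchCost_le_ten {π π' : Fin (2 ^ H) × Label p R →
      Option ((Fin (2 ^ H) × Label p R) ⊕ Fin (2 ^ H))} {c c' : Fin (2 ^ H) × Label p R → Fin k}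
    (hcard : Fintype.card (Label p R) = k) (h : Compatible π c) (h' : Compatible π' c') :
    (L.coloredCache h).fetchCost (L.coloredCache h') ≤ 10 * (2 ^ H * k) := by
  classical
  refine (L.fetchCost_coloredCache_le h h').trans ?_
  have hG : Fintype.card (Fin (2 ^ H) × Label p R) = 2 ^ H * k := by
    rw [Fintype.card_prod, Fintype.card_fin, hcard]
  refine (Nat.add_le_add (Nat.mul_le_mul_right 9 (Finset.card_le_univ _))
    (Finset.card_le_univ _)).trans ?_
  rw [hG]
  omega

/-- The offline algorithm keeps the same coloring during a whole phase. Hence only the wires at the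
ends of the blocks of the current level cost something. -/
theorem serveBound_phase [NeZero p] {j₀ N m : ℕ} (hH : H = j₀ + N) (S : Cache n k)
    (b : ℕ → ZMod 2) {m₀ : ℕ}
    (hS : S.fetchCost (L.coloredCache (compatible_baseWiring E (levelBits p j₀ b)
      (hH ▸ Nat.le_add_right j₀ N : j₀ ≤ H))) ≤ m₀) {t : ℕ} (ht : t ≤ N * p) :
    ∃ hj : j₀ + t / p ≤ H, ServeBound S (phase (stepRequests L j₀ m) b t)
      (L.coloredCache (compatible_baseWiring E (levelBits p j₀ b) hj))
      (m₀ + ∑ s ∈ Finset.range t, 2 * (2 ^ (H - (j₀ + s / p)) * k)) := by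
  have hcard : Fintype.card (Label p R) = k := by
    rw [Fintype.card_congr E, Fintype.card_fin]
  have hp := NeZero.pos p
  have hle : ∀ t ≤ N * p, j₀ + t / p ≤ H := by
    intro t ht
    have := Nat.div_le_of_le_mul (ht.trans (mul_comm N p).le)
    omega
  have hlt : ∀ t < N * p, j₀ + t / p < H := by
    intro t ht
    have := (Nat.div_lt_iff_lt_mul hp).2 ht
    omega
  induction t with
  | zero =>
    refine ⟨hle _ ht, ?_⟩
    simp only [Nat.zero_div, add_zero, Finset.range_zero, Finset.sum_empty]
    exact hS
  | succ t ih =>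
    obtain ⟨hj, hserve⟩ := ih (by omega)
    refine ⟨hle _ ht, ?_⟩
    have hj' := hlt t (by omega)
    have hcompat := compatible_testWiring E (levelBits p j₀ b) hj' (Fin.ofNat p t)
    rw [levelBits_apply] at hcompat
    have hbase := ServeBound.rounds m (Cache.fetchCost_self _).le
      fun e he => L.coloredCache_holds (compatible_baseWiring E (levelBits p j₀ b) hj) he
    have htest := ServeBound.rounds m
      (fetchCost_le_of_agree L hcard hj (compatible_baseWiring E (levelBits p j₀ b) hj) hcompat
        fun g hg => by rw [baseWiring_of_not_dvd hg, testWiring_of_not_dvd hg])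
      fun e he => L.coloredCache_holds hcompat he
    have hmono : j₀ + t / p ≤ j₀ + (t + 1) / p :=
      Nat.add_le_add_left (Nat.div_le_div_right (Nat.le_succ t)) _
    have hmove : ServeBound _ [] _ _ :=
      fetchCost_le_of_agree L hcard hj hcompat
        (compatible_baseWiring E (levelBits p j₀ b) (hle _ ht)) fun g hg => by
          rw [testWiring_of_not_dvd hg,
            baseWiring_of_not_dvd fun h => hg ((pow_dvd_pow 2 hmono).trans h),
            link_eq_link_of_le _ hmono hg]
    have := hserve.append ((hbase.append htest).append hmove)
    rw [List.append_nil] at this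
    refine this.mono (le_of_eq ?_)
    rw [Finset.sum_range_succ]
    ring

end Offline

/-- The lower bound for a competitive ratio that is proved with blocks of `2 ^ j₀`, …, `2 ^ H`
layers. -/
theorem ratio_ge_of_layout [NeZero p] [Fintype R] [Finite Y]
    (L : Layout n k (Fin (2 ^ H) × Label p R) (Fin (2 ^ H)) Y) {j₀ N : ℕ} (hH : H = j₀ + N) (hN : 0 < N)
    (hp : p ≤ 2 ^ j₀) (hkp : k ≤ 2 * 2 ^ p) (hcard : Fintype.card (Label p R) = k)
    {A : RandomizedAlgorithm n k} {c : ℝ} (hc : A.IsCompetitive c) :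
    (N * p : ℝ) ≤ 224 * c := by
  classical
  have := Fintype.ofFinite Y
  have hp0 := NeZero.pos p
  have hk0 := NeZero.pos k
  have E : Label p R ≃ Fin k := Fintype.equivFinOfCardEq hcard
  set m := 2 ^ H * 2 ^ p / 4 with hm
  have hm4 : 2 ^ H * 2 ^ p = 4 * m := by
    obtain ⟨h, hh⟩ : ∃ h, H = h + 1 := ⟨H - 1, by omega⟩
    obtain ⟨q, hq⟩ : ∃ q, p = q + 1 := ⟨p - 1, by omega⟩
    have : 2 ^ H * 2 ^ p = 4 * (2 ^ h * 2 ^ q) := by rw [hh, hq]; ring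
    rw [hm]
    omega
  -- per phase at most `10` insertions per gadget for the new coloring, and `4` for the wires
  have hbound : (((N * p : ℕ) : ℝ) * m) ≤ 2 * c * ((14 * (2 ^ H * k) : ℕ) : ℝ) := by
    refine ratio_le_of_adversary (req := stepRequests L j₀ m)
      (Z := {S | ∃ (b : ℕ → ZMod 2) (j : ℕ) (hj : j ≤ H),
        S = L.coloredCache (compatible_baseWiring E (levelBits p j₀ b) hj)})
      (stepRequests_congr L j₀ m) ?_ ?_ ?_ ?_ hc
    · intro t ht b B σ
      refine stepRequests_gain L hcard ?_ b B σ
      have := (Nat.div_lt_iff_lt_mul hp0).2 ht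
      omega
    · exact ⟨_, 0, 0, Nat.zero_le H, rfl⟩
    · rintro S ⟨b', j, hj, rfl⟩ b
      obtain ⟨hj', hserve⟩ := serveBound_phase (m := m) L E hH _ b
        (fetchCost_le_ten L hcard (compatible_baseWiring E (levelBits p j₀ b') hj) _) le_rfl
      refine ⟨_, ⟨b, _, hj', rfl⟩, hserve.mono ?_⟩
      have h₁ := sum_range_div (p := p) (fun i => 2 * (2 ^ (H - (j₀ + i)) * k)) N
      rw [h₁]
      have h₂ : ∑ i ∈ Finset.range N, 2 * (2 ^ (H - (j₀ + i)) * k) =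
          2 * k * ∑ i ∈ Finset.range N, 2 ^ (N - i) := by
        rw [Finset.mul_sum]
        refine Finset.sum_congr rfl fun i _ => ?_
        rw [hH, Nat.add_sub_add_left]
        ring
      rw [h₂]
      have h₃ : p * (2 * k * ∑ i ∈ Finset.range N, 2 ^ (N - i)) ≤
          2 ^ j₀ * (2 * k * (2 * 2 ^ N)) :=
        Nat.mul_le_mul hp (Nat.mul_le_mul_left _ (sum_two_pow_sub_le N))
      have h₄ : 2 ^ j₀ * (2 * k * (2 * 2 ^ N)) = 4 * (2 ^ H * k) := by
        rw [hH, pow_add]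
        ring
      omega
    · have : 0 < 2 ^ H * 2 ^ p := by positivity
      exact Nat.mul_pos (Nat.mul_pos hN hp0) (by omega)
  have hm4' : (2 : ℝ) ^ H * 2 ^ p = 4 * m := by exact_mod_cast hm4
  have hkp' : (k : ℝ) ≤ 2 * 2 ^ p := by exact_mod_cast hkp
  push_cast at hbound
  have h2H : (0 : ℝ) < 2 ^ H := by positivity
  have hk : (0 : ℝ) < k := by exact_mod_cast hk0
  have hNp : (0 : ℝ) ≤ N * p := by positivity
  have h₁ : (N * p : ℝ) * (2 ^ H * k) ≤ 224 * c * (2 ^ H * k) := by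
    have h₂ : (2 : ℝ) ^ H * k ≤ 8 * m := by nlinarith
    nlinarith [mul_le_mul_of_nonneg_left h₂ hNp]
  exact le_of_mul_le_mul_right h₁ (by positivity)

end Phases

/-! ### Edges at a single node -/

section Star

variable {n k p : ℕ} {R : Type*}

/-- The edges at a node of `V^in`, indexed by labels. -/
def starEdge (hn : k < n) (E : Label p R ≃ Fin (k + 1)) (i : Label p R) : Edge n :=
  (⟨0, by omega⟩, Fin.castLE hn (E i))

theorem starEdge_injective (hn : k < n) (E : Label p R ≃ Fin (k + 1)) :
    Function.Injective (starEdge hn E) := fun _ _ h =>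
  E.injective (Fin.castLE_injective hn (Prod.mk.inj h).2)

/-- The `k + 1` edges at a node cannot be cached at the same time. -/
theorem exists_starEdge_not_holds [Finite R] (hn : k < n) (E : Label p R ≃ Fin (k + 1))
    (S : Cache n k) :
    ∃ i, ¬ S.Holds (starEdge hn E i) := by
  by_contra! h
  choose f hf using h
  have hinj : Function.Injective f := by
    intro i i' hii
    have h₁ := hf i'
    rw [← hii] at h₁
    exact starEdge_injective hn E (S.isMatching _ _ (hf i) _ h₁ (.inl rfl))
  have := Fintype.card_le_of_injective (f ∘ E.symm) (hinj.comp E.symm.injective)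
  simp at this

open Classical in
/-- The edges at the node whose label does not have a given bit. -/
noncomputable def starEdges [Fintype R] (hn : k < n) (E : Label p R ≃ Fin (k + 1)) (r : Fin p)
    (β : ZMod 2) : Finset (Edge n) :=
  (Finset.univ.filter fun i => ¬ HasBit r β i).image (starEdge hn E)

theorem starEdges_gain [Fintype R] (hn : k < n) (E : Label p R ≃ Fin (k + 1)) (r : Fin p)
    (A : OnlineAlgorithm n k) (σ : List (Edge n)) :
    2 * A.cost σ + 1 ≤ A.cost (σ ++ rounds (starEdges hn E r 0) 1) +
      A.cost (σ ++ rounds (starEdges hn E r 1) 1) := by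
  classical
  obtain ⟨i, hi⟩ := exists_starEdge_not_holds hn E (A.cacheAfter σ)
  have key : ∀ β, ¬ HasBit r β i → A.cost σ < A.cost (σ ++ rounds (starEdges hn E r β) 1) := by
    intro β hβ
    refine lt_of_le_of_ne (A.cost_le_cost_append _ _) fun h => hi ?_
    refine A.holds_of_cost_append_eq h.symm ?_
    simp only [rounds, List.replicate_one, List.flatten_singleton, Finset.mem_toList, starEdges]
    exact Finset.mem_image_of_mem _ (Finset.mem_filter.2 ⟨Finset.mem_univ i, hβ⟩)
  have h₀ := A.cost_le_cost_append σ (rounds (starEdges hn E r 0) 1)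
  have h₁ := A.cost_le_cost_append σ (rounds (starEdges hn E r 1) 1)
  by_cases hb : HasBit r 0 i
  · have := key 1 fun hb' => absurd (hb.unique hb') (by decide)
    omega
  · have := key 0 hb
    omega

/-- The color of the edge with label `i` when the edge with label `x` is left out: the position of
the label among the first `k` ones; the last label takes the place of `x`. -/
noncomputable def starColor (E : Label p R ≃ Fin (k + 1)) (x i : Label p R) : Fin (k + 1) :=
  open Classical in if E i = Fin.last k then E x else E i

theorem starColor_injOn (E : Label p R ≃ Fin (k + 1)) {x i i' : Label p R} (hi : i ≠ x)
    (hi' : i' ≠ x) (h : starColor E x i = starColor E x i') : i = i' := by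
  unfold starColor at h
  split_ifs at h with h₁ h₂ h₂
  · exact E.injective (h₁.trans h₂.symm)
  · exact absurd (E.injective h).symm hi'
  · exact absurd (E.injective h) hi
  · exact E.injective h

theorem starColor_ne_last (E : Label p R ≃ Fin (k + 1)) {x i : Label p R} (hi : i ≠ x) :
    starColor E x i ≠ Fin.last k := by
  unfold starColor
  split_ifs with h
  · exact fun h' => hi (E.injective (h.trans h'.symm))
  · exact h

open Classical in
/-- The cache with all the edges at the node except the one with label `x`. -/
noncomputable def starCache (hn : k < n) (E : Label p R ≃ Fin (k + 1)) (x : Label p R) :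
    Cache n k where
  matching c := Finset.univ.filter fun e =>
    ∃ i, i ≠ x ∧ starColor E x i = c.castSucc ∧ e = starEdge hn E i
  isMatching := by
    intro c e he f hf _
    rw [Finset.mem_filter_univ] at he hf
    obtain ⟨i, hi, hc, rfl⟩ := he
    obtain ⟨i', hi', hc', rfl⟩ := hf
    rw [starColor_injOn E hi hi' (hc.trans hc'.symm)]

theorem starCache_holds (hn : k < n) (E : Label p R ≃ Fin (k + 1)) {x i : Label p R}
    (hi : i ≠ x) : (starCache hn E x).Holds (starEdge hn E i) := by
  obtain ⟨c, hc⟩ := Fin.exists_castSucc_eq.2 (starColor_ne_last E hi)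
  refine ⟨c, ?_⟩
  simp only [starCache, Finset.mem_filter_univ]
  exact ⟨i, hi, hc.symm, rfl⟩

theorem fetchCost_starCache_le (hn : k < n) (E : Label p R ≃ Fin (k + 1)) (x x' : Label p R) :
    (starCache hn E x).fetchCost (starCache hn E x') ≤ 2 := by
  classical
  set P : Finset (Label p R) := {x, E.symm (Fin.last k)} with hP
  have hsub : ∀ c : Fin k, (starCache hn E x').matching c \ (starCache hn E x).matching c ⊆
      (P.filter fun i => starColor E x' i = c.castSucc).image (starEdge hn E) := by
    intro c e he
    simp only [starCache, Finset.mem_sdiff, Finset.mem_filter_univ] at he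
    obtain ⟨⟨i, hi, hc, rfl⟩, hne⟩ := he
    refine Finset.mem_image_of_mem _ (Finset.mem_filter.2 ⟨?_, hc⟩)
    by_contra hiP
    rw [hP, Finset.mem_insert, Finset.mem_singleton, not_or] at hiP
    have hlast : E i ≠ Fin.last k := fun h => hiP.2 (by rw [← h, E.symm_apply_apply])
    refine hne ⟨i, hiP.1, ?_, rfl⟩
    rw [← hc, starColor, starColor, if_neg hlast, if_neg hlast]
  calc (starCache hn E x).fetchCost (starCache hn E x')
      ≤ ∑ c : Fin k, (P.filter fun i => starColor E x' i = c.castSucc).card :=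
        Finset.sum_le_sum fun c _ => (Finset.card_le_card (hsub c)).trans Finset.card_image_le
    _ ≤ ∑ c : Fin (k + 1), (P.filter fun i => starColor E x' i = c).card := by
        rw [Fin.sum_univ_castSucc]
        exact Nat.le_add_right _ _
    _ = P.card :=
        (Finset.card_eq_sum_card_fiberwise fun _ _ => Finset.mem_coe.2 (Finset.mem_univ _)).symm
    _ ≤ 2 := Finset.card_le_two

/-- The logarithmic lower bound that is already forced by `k + 1` edges at one node: each step
halves the set of the edges that the offline algorithm may have left out. -/
theorem ratio_ge_of_star [NeZero p] [Fintype R] (hn : k < n)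
    (hcard : Fintype.card (Label p R) = k + 1) {A : RandomizedAlgorithm n k} {c : ℝ}
    (hc : A.IsCompetitive c) : (p : ℝ) ≤ 4 * c := by
  classical
  have E : Label p R ≃ Fin (k + 1) := Fintype.equivFinOfCardEq hcard
  have hp := NeZero.pos p
  have := ratio_le_of_adversary (g := 1) (P := p) (m := 2)
    (req := fun t _ β => rounds (starEdges hn E (Fin.ofNat p t) β) 1)
    (Z := Set.range (starCache hn E)) (fun _ _ _ _ => rfl)
    (fun t _ _ B σ => starEdges_gain hn E (Fin.ofNat p t) B σ)
    ⟨_, ⟨.inl 0, rfl⟩⟩ ?_ (by omega) hc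
  · push_cast at this
    linarith
  · rintro _ ⟨x, rfl⟩ b
    set y : Label p R := .inl fun r => b r with hy
    refine ⟨_, ⟨y, rfl⟩, ServeBound.fetch_trans (m := 0) (fetchCost_starCache_le hn E x y)
      (ServeBound.of_holds ?_)⟩
    have hphase : ∀ t ≤ p, ∀ e ∈ phase (fun t _ β =>
        rounds (starEdges hn E (Fin.ofNat p t) β) 1) b t, (starCache hn E y).Holds e := by
      intro t
      induction t with
      | zero => simp [phase]
      | succ t ih =>
        intro ht e he
        rw [phase, List.mem_append] at he
        rcases he with he | he
        · exact ih (by omega) e he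
        · have he' := mem_of_mem_rounds he
          rw [starEdges, Finset.mem_image] at he'
          obtain ⟨i, hi, rfl⟩ := he'
          rw [Finset.mem_filter_univ] at hi
          refine starCache_holds hn E fun h => hi ?_
          refine ⟨_, h.trans hy, ?_⟩
          rw [Fin.val_ofNat, Nat.mod_eq_of_lt (by omega)]
    exact hphase p le_rfl

end Star

/-! ### Choice of the parameters -/

section Parameters

theorem card_label {p k : ℕ} (h : 2 ^ p ≤ k) :
    Fintype.card (Label p (Fin (k - 2 ^ p))) = k := by
  rw [Fintype.card_sum, Fintype.card_fun, ZMod.card, Fintype.card_fin, Fintype.card_fin]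
  omega

/-- The displacements come from any embedding of the colors into a group of exponent two of at most
twice the size; hence a gadget has at most `2 * k` nodes on each side. -/
theorem exists_layout {n k p H : ℕ} [NeZero k] (hpk : 2 ^ p ≤ k) (hkp : k ≤ 2 * 2 ^ p)
    (hn : 3 * k ^ 2 * 2 ^ H ≤ n) :
    Nonempty (Layout n k (Fin (2 ^ H) × Label p (Fin (k - 2 ^ p))) (Fin (2 ^ H))
      (Fin (p + 1) → ZMod 2)) := by
  have hY : Fintype.card (Fin (p + 1) → ZMod 2) = 2 * 2 ^ p := by
    rw [Fintype.card_fun, ZMod.card, Fintype.card_fin, pow_succ, mul_comm]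
  have hk := NeZero.pos k
  obtain ⟨f⟩ : Nonempty (Fin k ↪ (Fin (p + 1) → ZMod 2)) :=
    Function.Embedding.nonempty_of_card_le (by rw [hY, Fintype.card_fin]; exact hkp)
  obtain ⟨ι⟩ : Nonempty ((((Fin (2 ^ H) × Label p (Fin (k - 2 ^ p))) × (Fin (p + 1) → ZMod 2)) ⊕
      Fin (2 ^ H)) ↪ Fin n) := by
    refine Function.Embedding.nonempty_of_card_le ?_
    rw [Fintype.card_sum, Fintype.card_prod, Fintype.card_prod, card_label hpk, hY,
      Fintype.card_fin, Fintype.card_fin]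
    refine le_trans ?_ hn
    have h₁ : 2 ^ H * k * (2 * 2 ^ p) ≤ 2 ^ H * k * (2 * k) :=
      Nat.mul_le_mul_left _ (Nat.mul_le_mul_left _ hpk)
    have h₂ : 2 ^ H * 1 ≤ 2 ^ H * k ^ 2 := Nat.mul_le_mul_left _ (Nat.pow_pos hk)
    calc 2 ^ H * k * (2 * 2 ^ p) + 2 ^ H ≤ 2 ^ H * k * (2 * k) + 2 ^ H * k ^ 2 := by omega
      _ = 3 * k ^ 2 * 2 ^ H := by ring
  exact ⟨{
    shift := ⟨fun c => f c - f 0, fun c c' h => f.injective (sub_left_injective h)⟩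
    shift_zero := sub_self _
    add_self := add_self_bits
    place := ι }⟩

/-- The lower bound in terms of the binary logarithms, with an explicit constant. -/
theorem log_mul_log_le {n k : ℕ} (hk : 2 ≤ k) (hn : k < n) {A : RandomizedAlgorithm n k} {c : ℝ}
    (hc : A.IsCompetitive c) :
    Real.logb 2 (n / (k ^ 2 * Real.logb 2 k)) * Real.logb 2 k ≤ 896 * c := by
  set p := Nat.log 2 k with hp
  have hp1 : 1 ≤ p := Nat.log_pos (by norm_num) hk
  have hpk : 2 ^ p ≤ k := Nat.pow_log_le_self 2 (by omega)
  have hkp : k < 2 ^ (p + 1) := Nat.lt_pow_succ_log_self (by norm_num) k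
  have : NeZero p := ⟨by omega⟩
  have : NeZero k := ⟨by omega⟩
  set l := Real.logb 2 k with hl
  have hk0 : (0 : ℝ) < k := by positivity
  have hpl : (p : ℝ) ≤ l := by
    rw [hl, Real.le_logb_iff_rpow_le (by norm_num) hk0, Real.rpow_natCast]
    exact_mod_cast hpk
  have hlp : l ≤ p + 1 := by
    rw [hl, Real.logb_le_iff_le_rpow (by norm_num) hk0]
    have : (k : ℝ) ≤ 2 ^ (p + 1) := by exact_mod_cast hkp.le
    exact_mod_cast this
  have hp1' : (1 : ℝ) ≤ p := by exact_mod_cast hp1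
  have hl0 : 0 < l := by linarith
  have hstar : (p : ℝ) ≤ 4 * c :=
    ratio_ge_of_star (R := Fin (k + 1 - 2 ^ p)) hn (card_label (by omega)) hc
  set v : ℝ := n / (k ^ 2 * l) with hv
  have hn0 : (0 : ℝ) < n := by
    have : 0 < n := by omega
    exact_mod_cast this
  have hv0 : 0 < v := by positivity
  by_cases hsmall : Real.logb 2 v < 8
  -- with boundedly many levels the bound for the edges at one node suffices
  · nlinarith
  push Not at hsmall
  set H := Nat.log 2 (n / (3 * k ^ 2)) with hH
  set j₀ := Nat.log 2 p + 1 with hj₀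
  have hpj : p ≤ 2 ^ j₀ := (Nat.lt_pow_succ_log_self (by norm_num) p).le
  have hjp : 2 ^ j₀ ≤ 2 * p := by
    rw [hj₀, pow_succ, mul_comm]
    exact Nat.mul_le_mul_left 2 (Nat.pow_log_le_self 2 (by omega))
  have hk2 : 0 < 3 * k ^ 2 := by positivity
  have hnH : n < 3 * k ^ 2 * 2 ^ (H + 1) := by
    have := Nat.lt_pow_succ_log_self (b := 2) (by norm_num) (n / (3 * k ^ 2))
    rw [Nat.div_lt_iff_lt_mul hk2] at this
    rw [mul_comm]
    exact this
  -- the number of levels is `logb 2 v` up to a constant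
  have hlevels : Real.logb 2 v ≤ H + 4 - j₀ := by
    have h₁ : v * 2 ^ j₀ ≤ 2 ^ (H + 4) := by
      have h₂ : (n : ℝ) ≤ 3 * k ^ 2 * 2 ^ (H + 1) := by exact_mod_cast hnH.le
      have h₃ : (2 : ℝ) ^ j₀ ≤ 2 * l := by
        have : (2 : ℝ) ^ j₀ ≤ 2 * p := by exact_mod_cast hjp
        linarith
      have h₄ : v * l = n / k ^ 2 := by
        rw [hv]
        field_simp
      have h₅ : (n : ℝ) / k ^ 2 ≤ 3 * 2 ^ (H + 1) := by
        rw [div_le_iff₀ (by positivity)]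
        linarith
      have h₆ : (2 : ℝ) ^ (H + 4) = 8 * 2 ^ (H + 1) := by ring
      have h₇ := mul_le_mul_of_nonneg_left h₃ hv0.le
      have h₈ : (0 : ℝ) < 2 ^ (H + 1) := by positivity
      rw [h₆]
      linarith
    have h₂ : Real.logb 2 v + j₀ ≤ H + 4 := by
      have h₃ := Real.logb_le_logb_of_le (b := 2) (by norm_num) (by positivity) h₁
      rw [Real.logb_mul hv0.ne' (by positivity), Real.logb_pow, Real.logb_pow,
        Real.logb_self_eq_one (by norm_num)] at h₃
      push_cast at h₃
      linarith
    linarith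
  have hjH : j₀ < H := by
    have : (j₀ : ℝ) < H := by linarith
    exact_mod_cast this
  obtain ⟨N, hN⟩ := Nat.exists_eq_add_of_le hjH.le
  have hfit : 3 * k ^ 2 * 2 ^ H ≤ n := by
    have h₀ : n / (3 * k ^ 2) ≠ 0 := by
      intro h
      rw [h, Nat.log_zero_right] at hH
      omega
    rw [mul_comm]
    exact (Nat.mul_le_mul_right _ (Nat.pow_log_le_self 2 h₀)).trans (Nat.div_mul_le_self _ _)
  have hkp' : k ≤ 2 * 2 ^ p := by
    rw [pow_succ] at hkp
    omega
  obtain ⟨L⟩ := exists_layout hpk hkp' hfit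
  have hmain : (N * p : ℝ) ≤ 224 * c :=
    ratio_ge_of_layout L hN (by omega) hpj hkp' (card_label hpk) hc
  have hN' : (H : ℝ) = j₀ + N := by exact_mod_cast hN
  have h₁ : Real.logb 2 v / 2 ≤ N := by linarith
  have h₂ : l / 2 ≤ p := by linarith
  have h₃ : Real.logb 2 v / 2 * (l / 2) ≤ N * p :=
    mul_le_mul h₁ h₂ (by linarith) (Nat.cast_nonneg _)
  linarith

end Parameters

end CachingInMatchings

theorem mainTheorem3 :
    ∃ C : ℝ, 0 < C ∧
      ∀ (n k : ℕ), 2 ≤ k → k < n →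
        ∀ (A : CachingInMatchings.RandomizedAlgorithm n k) (c : ℝ),
          CachingInMatchings.RandomizedAlgorithm.IsCompetitive A c →
            C * (Real.logb 2 ((n : ℝ) / ((k : ℝ) ^ 2 * Real.logb 2 (k : ℝ))) *
              Real.logb 2 (k : ℝ)) ≤ c := by
  refine ⟨1 / 896, by norm_num, fun n k hk hn A c hc => ?_⟩
  have := CachingInMatchings.log_mul_log_le hk hn hc
  linarith
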